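/- Let $d\ge 1$ and let $p(x,y,z)$ be a probability density with respect to Lebesgue measure on $\mathbb R^d\times\mathbb R^d\times\mathbb R^d$. Write $p(x,z)$, $p(y,z)$, $p(z)$ for its marginals and $p(x|z)=p(x,z)/p(z)$. For each $n$, let $(X_i,Y_i,Z_i)$, $1\le i\le n$, be i.i.d. with density $p(x,y,z)$. *Batches.* Let $k=k(n)$, $m=m(n)$, $b=b(n)$ be natural numbers such that $k(n)=\Theta(n^{1/2+\epsilon_0})$ for some $\epsilon_0>0$, $b(n)=\Theta(n)$, $\lim_{n\to\infty}k(n)/(n-m(n))=0$, and, for all sufficiently large $n$, $k(n)\le m(n)\le n-k(n)$ and $b(n)\le n$. Put $b'=mk$ and $p_1=\frac{b}{b+b'}$. Let $\mathcal I_b$ and $\mathcal I_m$ be subsets of $\{1,\dots,n\}$ with $b$ and $m$ elements respectively, each picked uniformly at random without replacement and each independent of the data. For $\zeta\in\mathbb R^d$ let $\mathcal A^m(\zeta)$ be the set of indices of the $k$ nearest neighbors of $\zeta$ in Euclidean distance among the points $Z_j$ with $j\notin\mathcal I_m$ (ties broken by smaller index). *Losses.* Let $0<\tau<\frac12$ and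 let $\omega_\theta(x,y,z)\in[\tau,1-\tau]$ be the output of a classifier with parameter $\theta$, that is, the sigmoid of a measurable real-valued network output $f_\theta(x,y,z)$, clipped to $[\tau,1-\tau]$. The empirical cross-entropy loss is $$L_{\mathrm{emp}}(\omega_\theta)=-\frac{p_1}{b}\sum_{i\in\mathcal I_b}\log\omega_\theta(X_i,Y_i,Z_i)-\frac{1-p_1}{b'}\sum_{i\in\mathcal I_m}\ \sum_{j\in\mathcal A^m(Z_i)}\log\bigl(1-\omega_\theta(X_j,Y_i,Z_i)\bigr).$$ The expected cross-entropy loss is $$L(\omega_\theta)=-\mathbb E\bigl[Q\log\omega_\theta(X,Y,Z)+(1-Q)\log(1-\omega_\theta(X,Y,Z))\bigr],$$ where $Q=1$ with probability $p_1$ and $Q=0$ otherwise, and $(X,Y,Z)$ has density $p(x,y,z)$ given $Q=1$ and density $p(x|z)\,p(y,z)$ given $Q=0$. *Constants.* Let $\gamma_d$ be the minimal number of cones with apex at the origin and angle $\pi/6$ (between the axis and the boundary) that cover $\mathbb R^d$, and put $$\delta_1(\epsilon,c,M)=2\exp\Bigl(\frac{-2\epsilon^2k^2}{nc^2}\Bigr)+2\exp\Bigl(\frac{-2\epsilon^2k^2}{(n-m)c^2}\Bigr)+\exp\Bigl(\frac{-(n-m)\epsilon^2}{8M^2\gamma_d^2}\Bigr),$$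 $$\delta_2(\epsilon)=\delta_1\Bigl(\epsilon,\ \log\tfrac{1-\tau}{\tau},\ -\log\tau\Bigr),\qquad \delta_3(\epsilon)=\delta_2\Bigl(\frac{\epsilon}{3-2p_1}\Bigr)+2\exp\Biggl(\frac{-2\,b\,\epsilon^2}{\bigl((3-2p_1)\log\frac{1-\tau}{\tau}\bigr)^2}\Biggr).$$ **Proposition.** For every $\mu>0$ and every parameter $\theta$ there exists $n_0$ such that for all $n>n_0$, $$\mathbb P\bigl(\,|L_{\mathrm{emp}}(\omega_\theta)-L(\omega_\theta)|\ge\mu\,\bigr)\le\delta_3(\mu).$$ -/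

import Mathlib

open MeasureTheory ProbabilityTheory Filter Asymptotics
open scoped ENNReal Topology

noncomputable section

namespace IsolatedKNN

/-- `ℝ^d` with the Euclidean norm. -/
abbrev E (d : ℕ) : Type := EuclideanSpace ℝ (Fin d)

/-- Triples `(x, y, z)` of vectors in `ℝ^d`. -/
abbrev Triple (d : ℕ) : Type := E d × E d × E d

/-! ### The joint density and the product density `p(x|z) p(y,z)` -/

/-- `p` is a probability density on triples (with respect to Lebesgue measure). -/
structure IsDensity {d : ℕ} (p : Triple d → ℝ≥0∞) : Prop where
  measurable : Measurable p
  lintegral_eq_one : ∫⁻ w, p w = 1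

/-- The marginal density `p(x, z)`. -/
def densXZ {d : ℕ} (p : Triple d → ℝ≥0∞) (x z : E d) : ℝ≥0∞ := ∫⁻ y, p (x, y, z)

/-- The marginal density `p(y, z)`. -/
def densYZ {d : ℕ} (p : Triple d → ℝ≥0∞) (y z : E d) : ℝ≥0∞ := ∫⁻ x, p (x, y, z)

/-- The marginal density `p(z)`. -/
def densZ {d : ℕ} (p : Triple d → ℝ≥0∞) (z : E d) : ℝ≥0∞ := ∫⁻ x, ∫⁻ y, p (x, y, z)

/-- The conditional density `p(x | z) = p(x, z) / p(z)`. -/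
def condDensX {d : ℕ} (p : Triple d → ℝ≥0∞) (x z : E d) : ℝ≥0∞ := densXZ p x z / densZ p z

/-- The distribution of a triple with density `p(x, y, z)`. -/
def jointLaw {d : ℕ} (p : Triple d → ℝ≥0∞) : Measure (Triple d) :=
  (volume : Measure (Triple d)).withDensity p

/-- The distribution of a triple with density `p(x | z) p(y, z)`. -/
def prodLaw {d : ℕ} (p : Triple d → ℝ≥0∞) : Measure (Triple d) :=
  (volume : Measure (Triple d)).withDensity
    fun w => condDensX p w.1 w.2.2 * densYZ p w.2.1 w.2.2

/-! ### The classifier and the expected cross-entropy loss -/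

/-- The classifier: the real output `f` of the last linear layer of the network is passed through
the sigmoid function, and the result is clipped to `[τ, 1 - τ]`. -/
def classifier {d : ℕ} (τ : ℝ) (f : Triple d → ℝ) (w : Triple d) : ℝ :=
  max τ (min (1 - τ) (Real.sigmoid (f w)))

/-- The law of `(Q, (X, Y, Z))`, where `Q = 1` with probability `p₁` and `Q = 0` otherwise, and
where `(X, Y, Z)` has density `p(x, y, z)` given `Q = 1`, and `p(x | z) p(y, z)` given `Q = 0`. -/
def labelledLaw {d : ℕ} (p₁ : ℝ) (p : Triple d → ℝ≥0∞) : Measure (ℝ × Triple d) :=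
  ENNReal.ofReal p₁ • (Measure.dirac 1).prod (jointLaw p) +
    ENNReal.ofReal (1 - p₁) • (Measure.dirac 0).prod (prodLaw p)

/-- The expected cross-entropy loss
`L(ω) = - E [Q log ω(X, Y, Z) + (1 - Q) log (1 - ω(X, Y, Z))]`. -/
def expectedLoss {d : ℕ} (p₁ : ℝ) (p : Triple d → ℝ≥0∞) (ω : Triple d → ℝ) : ℝ :=
  -∫ v, (v.1 * Real.log (ω v.2) + (1 - v.1) * Real.log (1 - ω v.2)) ∂(labelledLaw p₁ p)

/-! ### Joint batch, isolated nearest neighbors, empirical loss -/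

/-- The point with index `l` precedes the point with index `j` in the ordering of `z₁, …, zₙ` by
distance to `ζ` (among points at equal distance, the smaller index comes first). -/
def Precedes {d n : ℕ} (z : Fin n → E d) (ζ : E d) (l j : Fin n) : Prop :=
  dist (z l) ζ < dist (z j) ζ ∨ (dist (z l) ζ = dist (z j) ζ ∧ l < j)

open Classical in
/-- The indices of the `k` nearest neighbors of `ζ` among the points `z i` with `i` outside the
isolated set `I`: those indices outside `I` that are preceded by fewer than `k` others. -/
def isolatedNeighbors {d n : ℕ} (I : Finset (Fin n)) (k : ℕ) (z : Fin n → E d) (ζ : E d) :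
    Finset (Fin n) :=
  Iᶜ.filter fun j => (Iᶜ.filter fun l => Precedes z ζ l j).card < k

/-- The part of the empirical loss that comes from the joint batch
`{(xᵢ, yᵢ, zᵢ) : i ∈ J}`, with `b` elements. -/
def jointBatchLoss {d n : ℕ} (b : ℕ) (J : Finset (Fin n)) (w : Fin n → Triple d)
    (ω : Triple d → ℝ) : ℝ :=
  -((1 / (b : ℝ)) * ∑ i ∈ J, Real.log (ω (w i)))

/-- The part of the empirical loss that comes from the product batch
`{(xⱼ, yᵢ, zᵢ) : i ∈ I, j a k-nearest neighbor of zᵢ outside I}`, with `m k` elements. -/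
def prodBatchLoss {d n : ℕ} (m k : ℕ) (I : Finset (Fin n)) (w : Fin n → Triple d)
    (ω : Triple d → ℝ) : ℝ :=
  -((1 / ((m * k : ℕ) : ℝ)) *
    ∑ i ∈ I, ∑ j ∈ isolatedNeighbors I k (fun l => (w l).2.2) (w i).2.2,
      Real.log (1 - ω ((w j).1, (w i).2.1, (w i).2.2)))

/-- The fraction `p₁ = b / (b + b')` of the joint batch, where `b' = m k`. -/
def jointFraction (m k b : ℕ) : ℝ := (b : ℝ) / ((b : ℝ) + ((m * k : ℕ) : ℝ))

/-- The empirical cross-entropy loss. -/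
def empiricalLoss {d n : ℕ} (m k b : ℕ) (J I : Finset (Fin n)) (w : Fin n → Triple d)
    (ω : Triple d → ℝ) : ℝ :=
  jointFraction m k b * jointBatchLoss b J w ω +
    (1 - jointFraction m k b) * prodBatchLoss m k I w ω

/-- `S` is a subset of `{1, …, n}` with `s` elements, picked uniformly at random, without
replacement and independently of the data `W`. -/
structure IsRandomSubset {Ω : Type*} [MeasurableSpace Ω] (P : Measure Ω) {d n : ℕ} (s : ℕ)
    (W : Fin n → Ω → Triple d) (S : Ω → Finset (Fin n)) : Prop where
  uniform : HasLaw S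
    (uniformOn (((Finset.univ : Finset (Fin n)).powersetCard s : Finset (Finset (Fin n))) :
      Set (Finset (Fin n)))) P
  indep : IndepFun (fun ω i => W i ω) S P

/-! ### The assumption on the batch sizes -/

/-- The growth conditions on the number `k` of neighbors, the size `m` of the isolated set and the
size `b` of the joint batch, as functions of the size `n` of the dataset. -/
structure BatchSizes (k m b : ℕ → ℕ) : Prop where
  k_growth : ∃ ε₀ : ℝ, 0 < ε₀ ∧
    (fun n => (k n : ℝ)) =Θ[atTop] fun n => (n : ℝ) ^ ((1 : ℝ) / 2 + ε₀)
  k_le_m : ∀ᶠ n in atTop, k n ≤ m n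
  m_add_k_le : ∀ᶠ n in atTop, m n + k n ≤ n
  neighbors_sparse : Tendsto (fun n => (k n : ℝ) / ((n : ℝ) - (m n : ℝ))) atTop (𝓝 0)
  b_growth : (fun n => (b n : ℝ)) =Θ[atTop] fun n => (n : ℝ)
  b_le : ∀ᶠ n in atTop, b n ≤ n

/-! ### The constants of the bound -/

/-- The cone with apex at the origin, axis `u` and angle `π / 6` (each of its nonzero vectors makes
an angle of at most `π / 6` with the axis). -/
def cone {d : ℕ} (u : E d) : Set (E d) :=
  {y | y = 0 ∨ InnerProductGeometry.angle u y ≤ Real.pi / 6}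

/-- `γ_d`: the minimal number of cones, centered at the origin and of angle `π / 6`, that cover
`ℝ^d`. -/
def coneNumber (d : ℕ) : ℕ :=
  sInf {N : ℕ | ∃ U : Finset (E d), U.card = N ∧ (∀ u ∈ U, u ≠ 0) ∧ ∀ y : E d, ∃ u ∈ U, y ∈ cone u}

/-- `δ₁(ε, c, M)`. -/
def delta1 (d n m k : ℕ) (ε c M : ℝ) : ℝ :=
  2 * Real.exp (-2 * ε ^ 2 * (k : ℝ) ^ 2 / ((n : ℝ) * c ^ 2)) +
    2 * Real.exp (-2 * ε ^ 2 * (k : ℝ) ^ 2 / (((n : ℝ) - (m : ℝ)) * c ^ 2)) +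
    Real.exp (-((n : ℝ) - (m : ℝ)) * ε ^ 2 / (8 * M ^ 2 * (coneNumber d : ℝ) ^ 2))

/-- `δ₂(ε) = δ₁(ε, log ((1 - τ) / τ), - log τ)`. -/
def delta2 (d n m k : ℕ) (τ ε : ℝ) : ℝ :=
  delta1 d n m k ε (Real.log ((1 - τ) / τ)) (-Real.log τ)

/-- `δ₃(ε)`. -/
def delta3 (d n m k b : ℕ) (τ ε : ℝ) : ℝ :=
  delta2 d n m k τ (ε / (3 - 2 * jointFraction m k b)) +
    2 * Real.exp (-2 * (b : ℝ) * ε ^ 2 /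
      ((3 - 2 * jointFraction m k b) * Real.log ((1 - τ) / τ)) ^ 2)

end IsolatedKNN

end

/-! ### McDiarmid's inequality -/

namespace IsolatedKNN

section BoundedDifferences

open scoped NNReal

/-! The loss splits into a joint-batch average, with mean `ℓ₁` under `jointLaw p`, and a
product-batch average, whose target is `ℓ₂`, the mean under `prodLaw p`. Put `ε = μ / (3 - 2 p₁)`.
If the first average is within `ε` of `ℓ₁` and the second within `3ε` of `ℓ₂`, the weighted error is
below `p₁ ε + (1 - p₁) 3ε = μ`. A union bound over the two exceptional events therefore suffices,
and each event involves only one of the random subsets, which can be fixed by conditioning on its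
value.

Fluctuations are controlled by McDiarmid's inequality. For the product batch the point is that one
datum has little influence. A datum inside the isolated set affects one inner sum of `k` terms. A
datum outside changes at most one neighbor in each of the `m` inner sums. Since `k ≤ m`, the
normalized average moves by at most `C / k`, where `C = log ((1 - τ) / τ)`. This yields exactly the
first summand of `delta1`; the other two enter only through being nonnegative.

The remaining `2ε` absorbs the bias of the product batch. Given all the points `Z`, the value `X j`
has density `p(x | Z j)` instead of `p(x | Z i)`, so the bias is at most the bound on the loss times
the mean `L¹` distance between these densities. The conditional density is approximated in `L¹` by a
continuous compactly supported `q`. The error at `Z i` is small directly; at the neighbors `Z j` it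
is small on average by Stone's lemma, since a point is a neighbor of at most a constant times `k`
others. For `q` itself, uniform continuity reduces the matter to neighbors being close, which has
probability near one when `k / (n - m)` is small, by tightness and a pigeonhole over small cells.
The bias only has to be eventually small, so any finite cover by narrow cones serves in Stone's
lemma. All estimates are uniform in the subset and the probability space, so `n₀` depends on
neither. -/

theorem abs_sub_le_sum_of_bounded_differences {X : Type*} {n : ℕ} {F : (Fin n → X) → ℝ}
    {c : Fin n → ℝ≥0} (hc : ∀ w i v, |F (Function.update w i v) - F w| ≤ c i)
    (w w₀ : Fin n → X) : |F w - F w₀| ≤ ∑ i, (c i : ℝ) := by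
  classical
  have key : ∀ s : Finset (Fin n), |F (s.piecewise w w₀) - F w₀| ≤ ∑ i ∈ s, (c i : ℝ) := by
    intro s
    induction s using Finset.induction_on with
    | empty => simp
    | insert j s hj ih =>
      rw [Finset.piecewise_insert, Finset.sum_insert hj]
      have h := hc (s.piecewise w w₀) j (w j)
      calc |F (Function.update (s.piecewise w w₀) j (w j)) - F w₀|
          ≤ |F (Function.update (s.piecewise w w₀) j (w j)) - F (s.piecewise w w₀)|
            + |F (s.piecewise w w₀) - F w₀| := abs_sub_le _ _ _
        _ ≤ _ := add_le_add h ih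
  simpa using key Finset.univ

/-- The left endpoint is the infimum. An interval of length exactly `c`, instead of `2c` around a
reference value, is what makes Hoeffding's lemma give the sharp constant. -/
theorem exists_mem_Icc_of_abs_sub_le {X : Type*} [Nonempty X] {H : X → ℝ} {c : ℝ}
    (hH : ∀ x y, |H x - H y| ≤ c) : ∃ a, ∀ x, H x ∈ Set.Icc a (a + c) := by
  obtain ⟨x₀⟩ := ‹Nonempty X›
  have hb : BddBelow (Set.range H) :=
    ⟨H x₀ - c, by rintro _ ⟨y, rfl⟩; have := abs_le.1 (hH x₀ y); linarith⟩
  refine ⟨⨅ x, H x, fun x => ⟨ciInf_le hb x, ?_⟩⟩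
  have : Nonempty X := ⟨x₀⟩
  have : H x - c ≤ ⨅ x, H x := le_ciInf fun y => by have := abs_le.1 (hH x y); linarith
  linarith

/-- A function of independent variables with bounded differences is sub-Gaussian. -/
theorem hasSubgaussianMGF_pi_of_bounded_differences {X : Type*} [MeasurableSpace X]
    (μ : Measure X) [IsProbabilityMeasure μ] {n : ℕ} (F : (Fin n → X) → ℝ) (hF : Measurable F)
    (c : Fin n → ℝ≥0) (hc : ∀ w i v, |F (Function.update w i v) - F w| ≤ c i) :
    HasSubgaussianMGF (fun w => F w - ∫ w', F w' ∂(Measure.pi fun _ : Fin n => μ))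
      (∑ i, (c i / 2) ^ 2) (Measure.pi fun _ : Fin n => μ) := by
  have : Nonempty X := μ.nonempty_of_neZero
  induction n with
  | zero =>
    have h0 : (fun w => F w - ∫ w', F w' ∂(Measure.pi fun _ : Fin 0 => μ)) = fun _ => 0 := by
      funext w
      have : F = fun _ => F w := by funext w'; rw [Subsingleton.elim w' w]
      rw [this]; simp
    rw [h0]; simp
  | succ n ih =>
    set π : Measure (Fin n → X) := Measure.pi fun _ => μ with hπ
    set ρ : Measure (Fin (n + 1) → X) := Measure.pi fun _ => μ with hρ
    obtain ⟨a, ha⟩ := exists_mem_Icc_of_abs_sub_le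
      (fun w w₀ => abs_sub_le_sum_of_bounded_differences hc w w₀)
    set C := ∑ i, (c i : ℝ)
    have hcons : Measurable fun q : X × (Fin n → X) => (Fin.cons q.1 q.2 : Fin (n + 1) → X) := by
      refine measurable_pi_iff.2 fun i => ?_
      refine Fin.cases ?_ (fun j => ?_) i
      · simpa using measurable_fst
      · simp only [Fin.cons_succ]
        exact (measurable_pi_apply j).comp measurable_snd
    have hmp : MeasurePreserving
        (fun q : X × (Fin n → X) => (Fin.cons q.1 q.2 : Fin (n + 1) → X)) (μ.prod π) ρ := by
      have h := (measurePreserving_piFinSuccAbove (fun _ : Fin (n + 1) => μ) 0).symm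
      convert h using 1
      ext q i
      simp [MeasurableEquiv.piFinSuccAbove, Fin.insertNthEquiv]
    have hFq : Measurable fun q : X × (Fin n → X) => F (Fin.cons q.1 q.2) := hF.comp hcons
    have hFx : ∀ x, Measurable fun u : Fin n → X => F (Fin.cons x u) := fun x =>
      hFq.comp measurable_prodMk_left
    have hintF : Integrable F ρ := Integrable.of_mem_Icc a (a + C) hF.aemeasurable (ae_of_all _ ha)
    have hintFq : Integrable (fun q : X × (Fin n → X) => F (Fin.cons q.1 q.2)) (μ.prod π) :=
      Integrable.of_mem_Icc a (a + C) hFq.aemeasurable (ae_of_all _ fun q => ha _)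
    have hintFx : ∀ x, Integrable (fun u : Fin n → X => F (Fin.cons x u)) π := fun x =>
      Integrable.of_mem_Icc a (a + C) (hFx x).aemeasurable (ae_of_all _ fun q => ha _)
    -- `H` is the conditional expectation of `F` given the first coordinate. It oscillates by at
    -- most `c 0`, while each section `F (Fin.cons x ·)` falls under the induction hypothesis; this
    -- is one step of the martingale decomposition.
    set H : X → ℝ := fun x => ∫ u, F (Fin.cons x u) ∂π with hH
    have hHm : Measurable H :=
      (hFq.stronglyMeasurable.integral_prod_right (ν := π)).measurable
    have hEH : ∫ w, F w ∂ρ = ∫ x, H x ∂μ := by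
      rw [← hmp.map_eq, integral_map hcons.aemeasurable hF.aestronglyMeasurable]
      exact integral_prod _ hintFq
    have hHc : ∀ x y, |H x - H y| ≤ c 0 := by
      intro x y
      rw [hH]
      simp only
      rw [← integral_sub (hintFx x) (hintFx y)]
      have hle : ∀ u, ‖F (Fin.cons x u) - F (Fin.cons y u)‖ ≤ c 0 := fun u => by
        have := hc (Fin.cons y u) 0 x
        rwa [Fin.update_cons_zero] at this
      simpa using norm_integral_le_of_norm_le_const (μ := π) (ae_of_all _ hle)
    obtain ⟨a', ha'⟩ := exists_mem_Icc_of_abs_sub_le hHc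
    have hsubH := hasSubgaussianMGF_of_mem_Icc (μ := μ) hHm.aemeasurable (ae_of_all _ ha')
    have hnn : ‖a' + (c 0 : ℝ) - a'‖₊ = c 0 := by
      rw [add_sub_cancel_left]; simp
    rw [hnn] at hsubH
    have hsubx : ∀ x, HasSubgaussianMGF (fun u => F (Fin.cons x u) - H x)
        (∑ i : Fin n, (c i.succ / 2) ^ 2) π := by
      intro x
      refine ih (fun u => F (Fin.cons x u)) (hFx x) (fun i => c i.succ) fun u i v => ?_
      have := hc (Fin.cons x u) i.succ v
      rwa [← Fin.cons_update] at this
    refine ⟨fun t => ?_, fun t => ?_⟩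
    · refine integrable_exp_mul_of_mem_Icc (a := a - ∫ w, F w ∂ρ) (b := a + C - ∫ w, F w ∂ρ)
        (hF.sub_const _).aemeasurable (ae_of_all _ fun w => ?_)
      have := ha w
      exact ⟨by linarith [this.1], by linarith [this.2]⟩
    · have hme : Measurable fun w => Real.exp (t * (F w - ∫ w', F w' ∂ρ)) :=
        ((hF.sub_const _).const_mul t).exp
      have hie : Integrable (fun q : X × (Fin n → X) =>
          Real.exp (t * (F (Fin.cons q.1 q.2) - ∫ w', F w' ∂ρ))) (μ.prod π) := by
        refine integrable_exp_mul_of_mem_Icc (a := a - ∫ w, F w ∂ρ) (b := a + C - ∫ w, F w ∂ρ)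
          (hFq.sub_const _).aemeasurable (ae_of_all _ fun q => ?_)
        have := ha (Fin.cons q.1 q.2)
        exact ⟨by linarith [this.1], by linarith [this.2]⟩
      rw [mgf, ← hmp.map_eq, integral_map hcons.aemeasurable
        (by rw [hmp.map_eq]; exact hme.aestronglyMeasurable), hmp.map_eq, integral_prod _ hie]
      -- The inner bound does not depend on `x`, so it leaves the outer integral and the variance
      -- proxies add up.
      have hinner : ∀ x, ∫ u, Real.exp (t * (F (Fin.cons x u) - ∫ w', F w' ∂ρ)) ∂π
          ≤ Real.exp ((∑ i : Fin n, (c i.succ / 2) ^ 2 : ℝ≥0) * t ^ 2 / 2) *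
            Real.exp (t * (H x - ∫ x, H x ∂μ)) := by
        intro x
        have h1 : ∀ u, Real.exp (t * (F (Fin.cons x u) - ∫ w', F w' ∂ρ))
            = Real.exp (t * (F (Fin.cons x u) - H x)) * Real.exp (t * (H x - ∫ x, H x ∂μ)) := by
          intro u
          rw [← Real.exp_add, hEH]; congr 1; ring
        simp_rw [h1]
        rw [integral_mul_const]
        exact mul_le_mul_of_nonneg_right ((hsubx x).mgf_le t) (Real.exp_pos _).le
      calc _ ≤ ∫ x, Real.exp ((∑ i : Fin n, (c i.succ / 2) ^ 2 : ℝ≥0) * t ^ 2 / 2) *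
            Real.exp (t * (H x - ∫ x, H x ∂μ)) ∂μ :=
            integral_mono hie.integral_prod_left ((hsubH.integrable_exp_mul t).const_mul _) hinner
        _ = Real.exp ((∑ i : Fin n, (c i.succ / 2) ^ 2 : ℝ≥0) * t ^ 2 / 2) *
            mgf (fun x => H x - ∫ x, H x ∂μ) μ t := by rw [integral_const_mul]; rfl
        _ ≤ Real.exp ((∑ i : Fin n, (c i.succ / 2) ^ 2 : ℝ≥0) * t ^ 2 / 2) *
            Real.exp (((c 0 / 2) ^ 2 : ℝ≥0) * t ^ 2 / 2) :=
            mul_le_mul_of_nonneg_left (hsubH.mgf_le t) (Real.exp_pos _).le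
        _ = _ := by
            rw [← Real.exp_add, Fin.sum_univ_succ]
            push_cast
            congr 1
            ring

/-- **McDiarmid's inequality**, two-sided. -/
theorem measureReal_abs_sub_integral_ge_le_of_bounded_differences {X : Type*} [MeasurableSpace X]
    (μ : Measure X) [IsProbabilityMeasure μ] {n : ℕ} (F : (Fin n → X) → ℝ) (hF : Measurable F)
    (c : Fin n → ℝ) (hc0 : ∀ i, 0 ≤ c i)
    (hc : ∀ w i v, |F (Function.update w i v) - F w| ≤ c i)
    {ε : ℝ} (hε : 0 ≤ ε) :
    (Measure.pi fun _ : Fin n => μ).real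
        {w | ε ≤ |F w - ∫ w', F w' ∂(Measure.pi fun _ : Fin n => μ)|}
      ≤ 2 * Real.exp (-2 * ε ^ 2 / ∑ i, c i ^ 2) := by
  lift c to Fin n → ℝ≥0 using hc0
  have h := hasSubgaussianMGF_pi_of_bounded_differences μ F hF c hc
  have h1 := h.measure_ge_le hε
  have h2 := h.neg.measure_ge_le hε
  have hexp : -ε ^ 2 / (2 * ((∑ i, (c i / 2) ^ 2 : ℝ≥0) : ℝ)) =
      -2 * ε ^ 2 / ∑ i, (c i : ℝ) ^ 2 := by
    push_cast
    simp_rw [div_pow]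
    rw [← Finset.sum_div]
    -- In the degenerate case both exponents are quotients by zero, hence zero.
    rcases eq_or_ne (∑ i, (c i : ℝ) ^ 2) 0 with h0 | h0
    · simp [h0]
    · field_simp
  rw [hexp] at h1 h2
  set I := ∫ w', F w' ∂(Measure.pi fun _ : Fin n => μ)
  have hsub : {w | ε ≤ |F w - I|} ⊆ {w | ε ≤ F w - I} ∪ {w | ε ≤ (-fun w => F w - I) w} := by
    intro w hw
    rcases le_abs.1 (show ε ≤ |F w - I| from hw) with h | h
    · exact Or.inl h
    · exact Or.inr h
  calc _ ≤ _ := measureReal_mono hsub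
    _ ≤ _ := measureReal_union_le _ _
    _ ≤ _ := by linarith

end BoundedDifferences

/-! ### Counting nearest neighbors -/

section Counting

/-- The rank, counting predecessors in `T`, increases strictly along `R`, so it is injective on `T`
with values below `T.card`. It is thus a bijection onto `range T.card`, and exactly `k` ranks lie
below `k`. -/
theorem card_filter_rank_lt {ι : Type*} (T : Finset ι) (R : ι → ι → Prop) [DecidableRel R]
    (hirr : ∀ a, ¬ R a a) (htrans : ∀ a b c, R a b → R b c → R a c)
    (htot : ∀ a b, a ≠ b → R a b ∨ R b a) {k : ℕ} (hk : k ≤ T.card) :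
    (T.filter fun j => (T.filter fun l => R l j).card < k).card = k := by
  classical
  set rk : ι → ℕ := fun j => (T.filter fun l => R l j).card with hrk
  have hlt : ∀ a ∈ T, ∀ b, R a b → rk a < rk b := by
    intro a ha b hab
    refine Finset.card_lt_card (Finset.ssubset_iff_of_subset ?_ |>.2 ⟨a, ?_, ?_⟩)
    · intro l hl
      rw [Finset.mem_filter] at hl ⊢
      exact ⟨hl.1, htrans _ _ _ hl.2 hab⟩
    · simp [ha, hab]
    · simp [hirr]
  have hinj : Set.InjOn rk T := by
    intro a ha b hb hab
    by_contra hne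
    rcases htot a b hne with h | h
    · exact (hlt a ha b h).ne hab
    · exact (hlt b hb a h).ne hab.symm
  have himg : T.image rk = Finset.range T.card := by
    refine Finset.eq_of_subset_of_card_le ?_ ?_
    · intro x hx
      obtain ⟨a, ha, rfl⟩ := Finset.mem_image.1 hx
      rw [Finset.mem_range]
      refine Finset.card_lt_card (Finset.ssubset_iff_of_subset (Finset.filter_subset _ _) |>.2
        ⟨a, ha, ?_⟩)
      simp [hirr]
    · rw [Finset.card_range, Finset.card_image_of_injOn hinj]
  have hfil : (T.filter fun j => rk j < k).image rk = Finset.range k := by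
    ext x
    have hx : x ∈ T.image rk ↔ x < T.card := by rw [himg, Finset.mem_range]
    simp only [Finset.mem_image, Finset.mem_filter, Finset.mem_range] at hx ⊢
    constructor
    · rintro ⟨a, ⟨-, ha⟩, rfl⟩
      exact ha
    · intro h
      obtain ⟨a, ha, rfl⟩ := hx.2 (h.trans_le hk)
      exact ⟨a, ⟨ha, h⟩, rfl⟩
  calc (T.filter fun j => rk j < k).card
      = ((T.filter fun j => rk j < k).image rk).card :=
        (Finset.card_image_of_injOn (hinj.mono fun a ha => (Finset.mem_filter.1 ha).1)).symm
    _ = k := by rw [hfil, Finset.card_range]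

theorem precedes_irrefl {d n : ℕ} (z : Fin n → E d) (ζ : E d) (a : Fin n) :
    ¬ Precedes z ζ a a := by
  simp [Precedes]

theorem precedes_trans {d n : ℕ} (z : Fin n → E d) (ζ : E d) (a b c : Fin n)
    (hab : Precedes z ζ a b) (hbc : Precedes z ζ b c) : Precedes z ζ a c := by
  unfold Precedes at *
  rcases hab with h | ⟨h, h'⟩ <;> rcases hbc with g | ⟨g, g'⟩
  · exact Or.inl (h.trans g)
  · exact Or.inl (g ▸ h)
  · exact Or.inl (h ▸ g)
  · exact Or.inr ⟨h.trans g, h'.trans g'⟩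

theorem precedes_total {d n : ℕ} (z : Fin n → E d) (ζ : E d) (a b : Fin n) (hab : a ≠ b) :
    Precedes z ζ a b ∨ Precedes z ζ b a := by
  unfold Precedes
  rcases lt_trichotomy (dist (z a) ζ) (dist (z b) ζ) with h | h | h
  · exact Or.inl (Or.inl h)
  · rcases lt_or_gt_of_ne hab with g | g
    · exact Or.inl (Or.inr ⟨h, g⟩)
    · exact Or.inr (Or.inr ⟨h.symm, g⟩)
  · exact Or.inr (Or.inl h)

theorem card_isolatedNeighbors {d n : ℕ} (I : Finset (Fin n)) {k : ℕ} (z : Fin n → E d) (ζ : E d)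
    (hk : k ≤ Iᶜ.card) : (isolatedNeighbors I k z ζ).card = k := by
  classical
  unfold isolatedNeighbors
  convert card_filter_rank_lt Iᶜ (Precedes z ζ) (precedes_irrefl z ζ) (precedes_trans z ζ)
    (precedes_total z ζ) hk

theorem mem_isolatedNeighbors {d n : ℕ} (I : Finset (Fin n)) {k : ℕ} (z : Fin n → E d) (ζ : E d)
    (j : Fin n) [DecidablePred fun l => Precedes z ζ l j] :
    j ∈ isolatedNeighbors I k z ζ ↔
      j ∉ I ∧ (Iᶜ.filter fun l => Precedes z ζ l j).card < k := by
  unfold isolatedNeighbors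
  rw [Finset.mem_filter, Finset.mem_compl]
  convert Iff.rfl

/-- Replacing one point changes at most one of the nearest neighbors. -/
theorem isolatedNeighbors_insert_subset {d n : ℕ} (I : Finset (Fin n)) (r : Fin n)
    (k : ℕ) (z : Fin n → E d) (ζ : E d) :
    isolatedNeighbors (insert r I) k z ζ ⊆ isolatedNeighbors I (k + 1) z ζ := by
  classical
  intro j hj
  rw [mem_isolatedNeighbors] at hj ⊢
  refine ⟨fun h => hj.1 (Finset.mem_insert_of_mem h), ?_⟩
  have hsub : (Iᶜ.filter fun l => Precedes z ζ l j) ⊆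
      insert r ((insert r I)ᶜ.filter fun l => Precedes z ζ l j) := by
    intro l hl
    simp only [Finset.mem_filter, Finset.mem_compl, Finset.mem_insert] at hl ⊢
    tauto
  calc _ ≤ _ := Finset.card_le_card hsub
    _ ≤ _ := Finset.card_insert_le _ _
    _ < k + 1 := by omega

theorem isolatedNeighbors_congr {d n : ℕ} {I : Finset (Fin n)} (k : ℕ) {z z' : Fin n → E d}
    (ζ : E d) (h : ∀ l, l ∉ I → z l = z' l) :
    isolatedNeighbors I k z ζ = isolatedNeighbors I k z' ζ := by
  classical
  ext j
  rw [mem_isolatedNeighbors, mem_isolatedNeighbors]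
  refine and_congr_right fun hj => ?_
  have : (Iᶜ.filter fun l => Precedes z ζ l j) = (Iᶜ.filter fun l => Precedes z' ζ l j) := by
    refine Finset.filter_congr fun l hl => ?_
    rw [Finset.mem_compl] at hl
    unfold Precedes
    rw [h l hl, h j hj]
  rw [this]

theorem isolatedNeighbors_subset {d n : ℕ} (I : Finset (Fin n)) (k : ℕ) (z : Fin n → E d)
    (ζ : E d) : isolatedNeighbors I k z ζ ⊆ Iᶜ := by
  unfold isolatedNeighbors
  exact Finset.filter_subset _ _

/-- Once the index `r` is deleted, the two configurations coincide and share their `k - 1` nearest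
neighbors. Each full neighbor set adds a single index to this common part, so the sums differ by one
value of `g` against one value of `g'`, both in an interval of length `C`. -/
theorem abs_sum_isolatedNeighbors_sub_le {d n : ℕ} (I : Finset (Fin n)) {k : ℕ} (hk0 : 0 < k)
    (hk : k ≤ Iᶜ.card) (r : Fin n) {z z' : Fin n → E d} (ζ : E d) {g g' : Fin n → ℝ} {a C : ℝ}
    (hz : ∀ l, l ≠ r → z l = z' l) (hgg : ∀ l, l ≠ r → g l = g' l)
    (hg : ∀ l, g l ∈ Set.Icc a (a + C)) (hg' : ∀ l, g' l ∈ Set.Icc a (a + C)) :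
    |∑ j ∈ isolatedNeighbors I k z ζ, g j - ∑ j ∈ isolatedNeighbors I k z' ζ, g' j| ≤ C := by
  classical
  have hC : 0 ≤ C := by have := hg r; linarith [this.1.trans this.2]
  by_cases hr : r ∈ I
  · have h1 : isolatedNeighbors I k z ζ = isolatedNeighbors I k z' ζ :=
      isolatedNeighbors_congr k ζ fun l hl => hz l (by rintro rfl; exact hl hr)
    have h2 : ∑ j ∈ isolatedNeighbors I k z' ζ, g j = ∑ j ∈ isolatedNeighbors I k z' ζ, g' j :=
      Finset.sum_congr rfl fun j hj => hgg j (by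
        rintro rfl
        exact (Finset.mem_compl.1 (isolatedNeighbors_subset _ _ _ _ hj)) hr)
    rw [h1, h2]
    simpa using hC
  -- From here `k` stands for the old `k - 1`, the number of neighbors that survive the deletion of
  -- `r`.
  obtain ⟨k, rfl⟩ : ∃ q, k = q + 1 := ⟨k - 1, by omega⟩
  set B := isolatedNeighbors (insert r I) k z ζ with hB
  have hB' : B = isolatedNeighbors (insert r I) k z' ζ :=
    isolatedNeighbors_congr k ζ fun l hl => hz l (by rintro rfl; simp at hl)
  have hcB : B.card = k := by
    refine card_isolatedNeighbors _ _ _ ?_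
    rw [Finset.compl_insert, Finset.card_erase_of_mem (Finset.mem_compl.2 hr)]
    omega
  have hrB : r ∉ B := fun h => by
    have := Finset.mem_compl.1 (isolatedNeighbors_subset _ _ _ _ h)
    simp at this
  have key : ∀ (y : Fin n → E d) (f : Fin n → ℝ), B ⊆ isolatedNeighbors I (k + 1) y ζ →
      ∃ q, ∑ j ∈ isolatedNeighbors I (k + 1) y ζ, f j = f q + ∑ j ∈ B, f j := by
    intro y f hsub
    have hc := card_isolatedNeighbors I y ζ hk
    have h1 : (isolatedNeighbors I (k + 1) y ζ \ B).card = 1 := by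
      rw [Finset.card_sdiff_of_subset hsub, hc, hcB]; omega
    obtain ⟨q, hq⟩ := Finset.card_eq_one.1 h1
    refine ⟨q, ?_⟩
    rw [← Finset.sum_sdiff hsub, hq, Finset.sum_singleton]
  obtain ⟨q, hq⟩ := key z g (isolatedNeighbors_insert_subset I r k z ζ)
  obtain ⟨q', hq'⟩ := key z' g' (hB' ▸ isolatedNeighbors_insert_subset I r k z' ζ)
  have hs : ∑ j ∈ B, g j = ∑ j ∈ B, g' j :=
    Finset.sum_congr rfl fun j hj => hgg j (by rintro rfl; exact hrB hj)
  rw [hq, hq', hs, add_sub_add_right_eq_sub, abs_le]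
  have h1 := hg q
  have h2 := hg' q'
  exact ⟨by linarith [h1.1, h2.2], by linarith [h1.2, h2.1]⟩

/-! ### Neighbor sets without tie-breaking, and Stone's lemma -/

open Classical in
/-- The indices in `V` other than `i` such that fewer than `k` points are strictly closer
to `z i`. -/
noncomputable def weakNeighbors {ι M : Type*} [PseudoMetricSpace M] (V : Finset ι) (k : ℕ) (z : ι → M) (i : ι) :
    Finset ι :=
  (V.erase i).filter fun j =>
    ((V.erase i).filter fun l => dist (z l) (z i) < dist (z j) (z i)).card < k

open Classical in
/-- Fewer than `k` other points with index in `V` are within distance `r` of `z i`. -/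
def IsSparse {ι M : Type*} [PseudoMetricSpace M] (V : Finset ι) (k : ℕ) (r : ℝ) (z : ι → M)
    (i : ι) : Prop :=
  ((V.erase i).filter fun l => dist (z l) (z i) < r).card < k

/-- Dropping the tie-break by index can only enlarge the neighbor set. The larger set depends on
distances alone, hence commutes with permutations of `V`, as the exchangeability arguments require.
-/
theorem isolatedNeighbors_subset_weakNeighbors {d n : ℕ} (I : Finset (Fin n)) (k : ℕ)
    (z : Fin n → E d) {i : Fin n} (hi : i ∈ I) :
    isolatedNeighbors I k z (z i) ⊆ weakNeighbors (insert i Iᶜ) k z i := by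
  classical
  intro j hj
  rw [mem_isolatedNeighbors] at hj
  have hV : (insert i Iᶜ).erase i = Iᶜ := Finset.erase_insert (by simpa using hi)
  unfold weakNeighbors
  rw [Finset.mem_filter]
  refine ⟨?_, lt_of_le_of_lt (Finset.card_le_card fun l hl => ?_) hj.2⟩
  · simp only [Finset.mem_erase, Finset.mem_insert, Finset.mem_compl]
    exact ⟨by rintro rfl; exact hj.1 hi, Or.inr hj.1⟩
  · simp only [Finset.mem_filter, Finset.mem_erase, Finset.mem_insert, Finset.mem_compl] at hl ⊢
    exact ⟨by tauto, Or.inl hl.2⟩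

theorem dist_lt_of_mem_weakNeighbors {ι M : Type*} [PseudoMetricSpace M] {V : Finset ι} {k : ℕ}
    {r : ℝ} {z : ι → M} {i j : ι} (hs : ¬ IsSparse V k r z i) (hj : j ∈ weakNeighbors V k z i) :
    dist (z j) (z i) < r := by
  classical
  unfold weakNeighbors at hj
  rw [Finset.mem_filter] at hj
  by_contra hr
  refine hs (lt_of_le_of_lt (Finset.card_le_card fun l hl => ?_) hj.2)
  rw [Finset.mem_filter] at hl ⊢
  exact ⟨hl.1, hl.2.trans_le (not_lt.1 hr)⟩

-- Points of `B` in the same cell are closer than `r` to each other, so a sparse point shares its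
-- cell with fewer than `k` other points. Each of the `N` cells thus holds at most `k` sparse
-- points.
open Classical in
theorem card_sparse_le {ι M : Type*} [PseudoMetricSpace M] (V : Finset ι) (k : ℕ)
    (r : ℝ) (z : ι → M) (B : Set M) {N : ℕ} (cell : M → Fin N)
    (hcell : ∀ a ∈ B, ∀ b ∈ B, cell a = cell b → dist a b < r) :
    (V.filter fun i => z i ∈ B ∧ IsSparse V k r z i).card ≤ k * N := by
  have h := Finset.card_le_mul_card_image_of_maps_to
    (s := V.filter fun i => z i ∈ B ∧ IsSparse V k r z i) (f := fun i => cell (z i))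
    (t := Finset.univ) (fun _ _ => Finset.mem_univ _) k ?_
  · simpa using h
  intro c _
  set F := (V.filter fun i => z i ∈ B ∧ IsSparse V k r z i).filter fun i => cell (z i) = c with hF
  rcases F.eq_empty_or_nonempty with h0 | ⟨i, hi⟩
  · simp [h0]
  have hi' := hi
  rw [hF, Finset.mem_filter, Finset.mem_filter] at hi'
  have h1 : (F.erase i).card < k := by
    refine lt_of_le_of_lt (Finset.card_le_card fun l hl => ?_) hi'.1.2.2
    rw [Finset.mem_erase, hF, Finset.mem_filter, Finset.mem_filter] at hl
    rw [Finset.mem_filter, Finset.mem_erase]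
    exact ⟨⟨hl.1, hl.2.1.1⟩, hcell _ hl.2.1.2.1 _ hi'.1.2.1 (hl.2.2.trans hi'.2.symm)⟩
  rw [Finset.card_erase_of_mem hi] at h1
  omega

/-- Partition of a totally bounded set into finitely many cells of small diameter. -/
theorem exists_cells {M : Type*} [PseudoMetricSpace M] {B : Set M} (hB : TotallyBounded B) {r : ℝ}
    (hr : 0 < r) : ∃ (N : ℕ) (cell : M → Fin (N + 1)),
      ∀ a ∈ B, ∀ b ∈ B, cell a = cell b → dist a b < r := by
  classical
  obtain ⟨t, htf, ht⟩ := Metric.totallyBounded_iff.1 hB (r / 2) (half_pos hr)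
  obtain ⟨N, f, rfl⟩ : ∃ (N : ℕ) (f : Fin N → M), t = Set.range f := by
    obtain ⟨N, f, hf⟩ := htf.fin_param
    exact ⟨N, f, hf.2.symm⟩
  have hex : ∀ a ∈ B, ∃ c : Fin N, dist a (f c) < r / 2 := by
    intro a ha
    have := ht ha
    simpa using this
  refine ⟨N, fun a => if h : a ∈ B then (hex a h).choose.castSucc else Fin.last N, ?_⟩
  intro a ha b hb hab
  simp only [ha, hb, dif_pos] at hab
  have h1 := (hex a ha).choose_spec
  have h2 := (hex b hb).choose_spec
  rw [← Fin.castSucc_injective _ hab] at h2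
  calc dist a b ≤ dist a _ + dist b _ := dist_triangle_right _ _ _
    _ < r := by linarith

/-- A finite-dimensional space is covered by finitely many narrow cones: of two vectors in the same
cone, the shorter one is closer to the longer one than the apex is. -/
theorem exists_narrow_cones (F : Type*) [NormedAddCommGroup F] [InnerProductSpace ℝ F]
    [FiniteDimensional ℝ F] : ∃ (N : ℕ) (c : F → Fin (N + 1)), ∀ a b : F, a ≠ 0 → b ≠ 0 →
      c a = c b → ‖a‖ ≤ ‖b‖ → ‖a - b‖ < ‖b‖ := by
  have : ProperSpace F := FiniteDimensional.proper ℝ F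
  obtain ⟨N, cell, hcell⟩ := exists_cells (isCompact_sphere (0 : F) 1).totallyBounded one_pos
  refine ⟨N, fun a => cell (‖a‖⁻¹ • a), fun a b ha hb hab hle => ?_⟩
  have hna : 0 < ‖a‖ := norm_pos_iff.2 ha
  have hnb : 0 < ‖b‖ := norm_pos_iff.2 hb
  have h1 : ∀ x : F, x ≠ 0 → ‖‖x‖⁻¹ • x‖ = 1 := fun x hx => by
    rw [norm_smul, norm_inv, norm_norm, inv_mul_cancel₀ (norm_ne_zero_iff.2 hx)]
  have hd := hcell _ (by simpa using h1 a ha) _ (by simpa using h1 b hb) hab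
  rw [dist_eq_norm] at hd
  have h2 : ‖‖a‖⁻¹ • a - ‖b‖⁻¹ • b‖ ^ 2 < 1 := by
    have := norm_nonneg (‖a‖⁻¹ • a - ‖b‖⁻¹ • b)
    nlinarith
  rw [norm_sub_sq_real, h1 a ha, h1 b hb, real_inner_smul_left, real_inner_smul_right] at h2
  -- The unit vectors are at distance less than one, so their angle is below `π / 3` and its cosine
  -- exceeds one half. With `‖a‖ ≤ ‖b‖` this gives `‖a‖ ^ 2 < 2 ⟪a, b⟫`.
  have h3 : ‖a‖ * ‖b‖ < 2 * inner ℝ a b := by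
    have h4 : 1 < 2 * (‖a‖⁻¹ * (‖b‖⁻¹ * inner ℝ a b)) := by linarith
    have h5 : ‖a‖⁻¹ * (‖b‖⁻¹ * inner ℝ a b) * (‖a‖ * ‖b‖) = inner ℝ a b := by
      field_simp
    nlinarith [mul_pos hna hnb]
  have h6 : ‖a - b‖ ^ 2 < ‖b‖ ^ 2 := by
    rw [norm_sub_sq_real]
    nlinarith
  exact lt_of_pow_lt_pow_left₀ 2 hnb.le h6

-- Split the points having `z j` as a weak neighbor by the cone, with apex `z j`, that contains
-- them. In one cone take the point `z i` farthest from the apex: all the others are closer to `z i`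
-- than `z j` is, and since `j` is a weak neighbor of `i` there are fewer than `k` of them.
-- Distinctness of the points keeps differences away from the apex, where the cones say nothing.
open Classical in
theorem card_filter_mem_weakNeighbors_le {ι F : Type*} [NormedAddCommGroup F]
    {N : ℕ} {c : F → Fin N}
    (hc : ∀ a b : F, a ≠ 0 → b ≠ 0 → c a = c b → ‖a‖ ≤ ‖b‖ → ‖a - b‖ < ‖b‖)
    (V : Finset ι) (k : ℕ) {z : ι → F} (hz : ∀ i j, i ≠ j → z i ≠ z j) {j : ι} (hj : j ∈ V) :
    (V.filter fun i => j ∈ weakNeighbors V k z i).card ≤ k * N := by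
  have h := Finset.card_le_mul_card_image_of_maps_to
    (s := V.filter fun i => j ∈ weakNeighbors V k z i) (f := fun i => c (z i - z j))
    (t := Finset.univ) (fun _ _ => Finset.mem_univ _) k ?_
  · simpa using h
  intro q _
  set A := (V.filter fun i => j ∈ weakNeighbors V k z i).filter fun i => c (z i - z j) = q with hA
  rcases A.eq_empty_or_nonempty with h0 | hne
  · simp [h0]
  obtain ⟨i, hi, hmax⟩ := Finset.exists_max_image A (fun i => ‖z i - z j‖) hne
  have hmem : ∀ l ∈ A, l ∈ V ∧ l ≠ j ∧ j ∈ weakNeighbors V k z l ∧ c (z l - z j) = q := by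
    intro l hl
    rw [hA, Finset.mem_filter, Finset.mem_filter] at hl
    refine ⟨hl.1.1, ?_, hl.1.2, hl.2⟩
    rintro rfl
    have := hl.1.2
    simp [weakNeighbors] at this
  obtain ⟨hiV, hij, hjn, hci⟩ := hmem i hi
  have hcard : ((V.erase i).filter fun l => dist (z l) (z i) < dist (z j) (z i)).card < k := by
    unfold weakNeighbors at hjn
    exact (Finset.mem_filter.1 hjn).2
  have h1 : (A.erase i).card < k := by
    refine lt_of_le_of_lt (Finset.card_le_card fun l hl => ?_) hcard
    rw [Finset.mem_erase] at hl
    obtain ⟨hlV, hlj, -, hcl⟩ := hmem l hl.2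
    rw [Finset.mem_filter, Finset.mem_erase]
    refine ⟨⟨hl.1, hlV⟩, ?_⟩
    have := hc (z l - z j) (z i - z j) (sub_ne_zero.2 (hz l j hlj)) (sub_ne_zero.2 (hz i j hij))
      (hcl.trans hci.symm) (hmax l hl.2)
    rw [sub_sub_sub_cancel_right] at this
    rwa [dist_eq_norm, dist_comm, dist_eq_norm]
  rw [Finset.card_erase_of_mem hi] at h1
  omega

/-- **Stone's lemma**, in counting form. -/
theorem sum_sum_weakNeighbors_le {ι F : Type*} [NormedAddCommGroup F]
    {N : ℕ} {c : F → Fin N}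
    (hc : ∀ a b : F, a ≠ 0 → b ≠ 0 → c a = c b → ‖a‖ ≤ ‖b‖ → ‖a - b‖ < ‖b‖)
    (V : Finset ι) (k : ℕ) {z : ι → F} (hz : ∀ i j, i ≠ j → z i ≠ z j) (h : ι → ℝ≥0∞) :
    ∑ i ∈ V, ∑ j ∈ weakNeighbors V k z i, h j ≤ ((k * N : ℕ) : ℝ≥0∞) * ∑ j ∈ V, h j := by
  classical
  rw [Finset.sum_comm' (t' := V) (s' := fun j => V.filter fun i => j ∈ weakNeighbors V k z i),
    Finset.mul_sum]
  · refine Finset.sum_le_sum fun j hj => ?_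
    rw [Finset.sum_const, nsmul_eq_mul]
    gcongr
    exact card_filter_mem_weakNeighbors_le hc V k hz hj
  · intro i j
    rw [Finset.mem_filter]
    refine ⟨fun hh => ⟨⟨hh.1, hh.2⟩, ?_⟩, fun hh => hh.1⟩
    have := hh.2
    unfold weakNeighbors at this
    exact Finset.mem_of_mem_erase (Finset.mem_filter.1 this).1

end Counting

/-! ### Expectations over an i.i.d. sample -/

section Exchangeable

/-! ### Permutation invariance of the neighbor relations -/

theorem mem_weakNeighbors {ι M : Type*} [DecidableEq ι] [PseudoMetricSpace M] (V : Finset ι)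
    (k : ℕ) (z : ι → M) (i j : ι) : j ∈ weakNeighbors V k z i ↔ (j ≠ i ∧ j ∈ V) ∧
      ((V.erase i).filter fun l => dist (z l) (z i) < dist (z j) (z i)).card < k := by
  have h : j ∈ weakNeighbors V k z i ↔ _ := Finset.mem_filter
  rw [h]
  convert Iff.rfl
  simp

theorem weakNeighbors_subset {ι M : Type*} [PseudoMetricSpace M] (V : Finset ι)
    (k : ℕ) (z : ι → M) (i : ι) : weakNeighbors V k z i ⊆ V := by
  classical
  exact fun j hj => ((mem_weakNeighbors V k z i j).1 hj).1.2

theorem isSparse_iff {ι M : Type*} [DecidableEq ι] [PseudoMetricSpace M] (V : Finset ι)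
    (k : ℕ) (r : ℝ) (z : ι → M) (i : ι) : IsSparse V k r z i ↔
      ((V.erase i).filter fun l => dist (z l) (z i) < r).card < k := by
  unfold IsSparse
  convert Iff.rfl

theorem card_filter_erase_comp {ι : Type*} [DecidableEq ι] {V : Finset ι} {σ : Equiv.Perm ι}
    (hσ : ∀ l, σ l ∈ V ↔ l ∈ V) (i : ι) (p : ι → Prop) [DecidablePred p] :
    ((V.erase i).filter fun l => p (σ l)).card = ((V.erase (σ i)).filter p).card := by
  refine Finset.card_equiv σ fun l => ?_
  simp [hσ]

theorem mem_weakNeighbors_comp {ι M : Type*} [PseudoMetricSpace M] {V : Finset ι}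
    {σ : Equiv.Perm ι} (hσ : ∀ l, σ l ∈ V ↔ l ∈ V) (k : ℕ) (z : ι → M) (i j : ι) :
    j ∈ weakNeighbors V k (z ∘ σ) i ↔ σ j ∈ weakNeighbors V k z (σ i) := by
  classical
  rw [mem_weakNeighbors, mem_weakNeighbors, hσ, σ.injective.ne_iff,
    ← card_filter_erase_comp hσ i fun l => dist (z l) (z (σ i)) < dist (z (σ j)) (z (σ i))]
  rfl

theorem isSparse_comp {ι M : Type*} [PseudoMetricSpace M] {V : Finset ι}
    {σ : Equiv.Perm ι} (hσ : ∀ l, σ l ∈ V ↔ l ∈ V) (k : ℕ) (r : ℝ) (z : ι → M) (i : ι) :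
    IsSparse V k r (z ∘ σ) i ↔ IsSparse V k r z (σ i) := by
  classical
  rw [isSparse_iff, isSparse_iff,
    ← card_filter_erase_comp hσ i fun l => dist (z l) (z (σ i)) < r]
  rfl

theorem swap_mem_iff {ι : Type*} [DecidableEq ι] {V : Finset ι} {i i' : ι} (hi : i ∈ V)
    (hi' : i' ∈ V) (l : ι) : Equiv.swap i i' l ∈ V ↔ l ∈ V := by
  rcases eq_or_ne l i with rfl | h1
  · simp [hi, hi']
  rcases eq_or_ne l i' with rfl | h2
  · simp [hi, hi']
  rw [Equiv.swap_apply_of_ne_of_ne h1 h2]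

/-! ### Measurability of the neighbor events -/

theorem measurableSet_card_filter_lt {α ι : Type*} [MeasurableSpace α] (T : Finset ι)
    (p : α → ι → Prop) [∀ a, DecidablePred (p a)] (hp : ∀ l, MeasurableSet {a | p a l}) (k : ℕ) :
    MeasurableSet {a | (T.filter (p a)).card < k} := by
  classical
  have h : Measurable fun a => (T.filter (p a)).card := by
    have : (fun a => (T.filter (p a)).card) = fun a => ∑ l ∈ T, if p a l then 1 else 0 := by
      funext a
      rw [Finset.card_filter]
    rw [this]
    exact Finset.measurable_sum _ fun l _ => Measurable.ite (hp l) measurable_const measurable_const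
  exact h measurableSet_Iio

variable {X : Type*} [MeasurableSpace X] {n : ℕ}

theorem measurableSet_mem_weakNeighbors {M : Type*} [PseudoMetricSpace M] [MeasurableSpace M]
    [OpensMeasurableSpace M] [SecondCountableTopology M] (V : Finset (Fin n)) (k : ℕ)
    {φ : X → M} (hφ : Measurable φ) (i j : Fin n) :
    MeasurableSet {w : Fin n → X | j ∈ weakNeighbors V k (fun l => φ (w l)) i} := by
  classical
  simp_rw [mem_weakNeighbors]
  have hm : ∀ l, Measurable fun w : Fin n → X => φ (w l) := fun l =>
    hφ.comp (measurable_pi_apply l)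
  refine (MeasurableSet.const _).inter (measurableSet_card_filter_lt _ _ (fun l => ?_) k)
  exact measurableSet_lt ((hm l).dist (hm i)) ((hm j).dist (hm i))

theorem measurableSet_isSparse {M : Type*} [PseudoMetricSpace M] [MeasurableSpace M]
    [OpensMeasurableSpace M] [SecondCountableTopology M] (V : Finset (Fin n)) (k : ℕ) (r : ℝ)
    {φ : X → M} (hφ : Measurable φ) (i : Fin n) :
    MeasurableSet {w : Fin n → X | IsSparse V k r (fun l => φ (w l)) i} := by
  classical
  simp_rw [isSparse_iff]
  have hm : ∀ l, Measurable fun w : Fin n → X => φ (w l) := fun l =>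
    hφ.comp (measurable_pi_apply l)
  refine measurableSet_card_filter_lt _ _ (fun l => ?_) k
  exact measurableSet_lt ((hm l).dist (hm i)) measurable_const

theorem measurableSet_mem_isolatedNeighbors {d : ℕ} (I : Finset (Fin n)) (k : ℕ)
    {φ : X → E d} (hφ : Measurable φ) (i j : Fin n) :
    MeasurableSet {w : Fin n → X | j ∈ isolatedNeighbors I k (fun l => φ (w l)) (φ (w i))} := by
  classical
  simp_rw [mem_isolatedNeighbors]
  have hm : ∀ l, Measurable fun w : Fin n → X => dist (φ (w l)) (φ (w i)) := fun l =>
    (hφ.comp (measurable_pi_apply l)).dist (hφ.comp (measurable_pi_apply i))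
  refine (MeasurableSet.const _).inter (measurableSet_card_filter_lt _ _ (fun l => ?_) k)
  exact (measurableSet_lt (hm l) (hm j)).union
    ((measurableSet_eq_fun (hm l) (hm j)).inter (MeasurableSet.const _))

/-! ### Resampling and permuting an i.i.d. sample -/

variable (P : Measure X) [IsProbabilityMeasure P]

theorem measurable_update_prod (j : Fin n) :
    Measurable fun q : X × (Fin n → X) => Function.update q.2 j q.1 := by
  refine measurable_pi_iff.2 fun i => ?_
  rcases eq_or_ne i j with rfl | h
  · simpa using measurable_fst
  · simp only [Function.update_of_ne h]
    exact (measurable_pi_apply i).comp measurable_snd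

/-- Resampling one coordinate does not change the law of an i.i.d. sample. -/
theorem measurePreserving_update (j : Fin n) :
    MeasurePreserving (fun q : X × (Fin n → X) => Function.update q.2 j q.1)
      (P.prod (Measure.pi fun _ : Fin n => P)) (Measure.pi fun _ : Fin n => P) := by
  classical
  refine ⟨measurable_update_prod j, (Measure.pi_eq fun s hs => ?_).symm⟩
  rw [Measure.map_apply (measurable_update_prod j) (MeasurableSet.univ_pi hs)]
  have : (fun q : X × (Fin n → X) => Function.update q.2 j q.1) ⁻¹' Set.univ.pi s =
      s j ×ˢ Set.univ.pi (Function.update s j Set.univ) := by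
    ext q
    simp only [Set.mem_preimage, Set.mem_pi, Set.mem_univ, true_imp_iff, Set.mem_prod]
    constructor
    · intro h
      refine ⟨by simpa using h j, fun i => ?_⟩
      rcases eq_or_ne i j with rfl | hij
      · simp
      · simpa [hij] using h i
    · rintro ⟨h1, h2⟩ i
      rcases eq_or_ne i j with rfl | hij
      · simpa using h1
      · simpa [hij] using h2 i
  rw [this, Measure.prod_prod, Measure.pi_pi, ← Finset.mul_prod_erase Finset.univ _
    (Finset.mem_univ j), ← Finset.mul_prod_erase Finset.univ (fun i => P (s i)) (Finset.mem_univ j)]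
  simp only [Function.update_self, measure_univ, one_mul]
  congr 1
  refine Finset.prod_congr rfl fun i hi => ?_
  rw [Function.update_of_ne (Finset.ne_of_mem_erase hi)]

theorem lintegral_pi_eq_lintegral_update (j : Fin n) {F : (Fin n → X) → ℝ≥0∞}
    (hF : Measurable F) :
    ∫⁻ w, F w ∂(Measure.pi fun _ : Fin n => P) =
      ∫⁻ w, ∫⁻ v, F (Function.update w j v) ∂P ∂(Measure.pi fun _ : Fin n => P) := by
  conv_lhs => rw [← (measurePreserving_update P j).map_eq]
  rw [lintegral_map hF (measurable_update_prod j),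
    lintegral_prod_symm (fun q : X × (Fin n → X) => F (Function.update q.2 j q.1)) (hF.comp (measurable_update_prod j)).aemeasurable]

theorem lintegral_pi_eval (j : Fin n) {f : X → ℝ≥0∞} (hf : Measurable f) :
    ∫⁻ w, f (w j) ∂(Measure.pi fun _ : Fin n => P) = ∫⁻ v, f v ∂P := by
  rw [lintegral_pi_eq_lintegral_update P j (F := fun w => f (w j))
    (hf.comp (measurable_pi_apply j))]
  simp

theorem lintegral_pi_comp_perm (σ : Equiv.Perm (Fin n)) {F : (Fin n → X) → ℝ≥0∞}
    (hF : Measurable F) :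
    ∫⁻ w, F (w ∘ σ) ∂(Measure.pi fun _ : Fin n => P) =
      ∫⁻ w, F w ∂(Measure.pi fun _ : Fin n => P) := by
  have hm : Measurable fun w : Fin n → X => w ∘ σ :=
    measurable_pi_iff.2 fun i => measurable_pi_apply (σ i)
  have hmap : (Measure.pi fun _ : Fin n => P).map (fun w => w ∘ σ) =
      Measure.pi fun _ : Fin n => P := by
    refine (Measure.pi_eq fun s hs => ?_).symm
    rw [Measure.map_apply hm (MeasurableSet.univ_pi hs)]
    have : (fun w : Fin n → X => w ∘ σ) ⁻¹' Set.univ.pi s =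
        Set.univ.pi fun i => s (σ.symm i) := by
      ext w
      simp only [Set.mem_preimage, Set.mem_pi, Set.mem_univ, true_imp_iff, Function.comp]
      exact ⟨fun h i => by simpa using h (σ.symm i), fun h i => by simpa using h (σ i)⟩
    rw [this, Measure.pi_pi]
    exact Equiv.prod_comp σ.symm fun i => P (s i)
  conv_rhs => rw [← hmap]
  rw [lintegral_map hF hm]

/-- A transposition of two indices of `V` preserves both `V` and the product law, so all summands
agree. This turns a deterministic count over `V` into a bound on the expectation at a single index.
-/
theorem lintegral_pi_eq_of_exchangeable {V : Finset (Fin n)} (F : Fin n → (Fin n → X) → ℝ≥0∞)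
    (hFm : ∀ i, Measurable (F i))
    (hF : ∀ (σ : Equiv.Perm (Fin n)), (∀ l, σ l ∈ V ↔ l ∈ V) → ∀ i w, F i (w ∘ σ) = F (σ i) w)
    {i : Fin n} (hi : i ∈ V) :
    ∑ i' ∈ V, ∫⁻ w, F i' w ∂(Measure.pi fun _ : Fin n => P) =
      V.card * ∫⁻ w, F i w ∂(Measure.pi fun _ : Fin n => P) := by
  rw [← nsmul_eq_mul]
  refine Finset.sum_eq_card_nsmul fun i' hi' => ?_
  rw [← lintegral_pi_comp_perm P (Equiv.swap i i') (hFm i)]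
  refine lintegral_congr fun w => ?_
  rw [hF _ (swap_mem_iff hi hi'), Equiv.swap_apply_left]

/-- Resample coordinate `i` with the others held fixed: it must hit the single value `φ (w j)`,
which has probability zero. -/
theorem ae_pi_injective {F : Type*} [MeasurableSpace F] [MeasurableEq F]
    {φ : X → F} (hφ : Measurable φ) (hP : ∀ c, P {v | φ v = c} = 0) :
    ∀ᵐ w ∂(Measure.pi fun _ : Fin n => P), ∀ i j, i ≠ j → φ (w i) ≠ φ (w j) := by
  refine ae_all_iff.2 fun i => ae_all_iff.2 fun j => ?_
  by_cases hij : i = j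
  · simp [hij]
  have hs : MeasurableSet {w : Fin n → X | φ (w i) = φ (w j)} :=
    measurableSet_eq_fun (hφ.comp (measurable_pi_apply i)) (hφ.comp (measurable_pi_apply j))
  have h0 : (Measure.pi fun _ : Fin n => P) {w : Fin n → X | φ (w i) = φ (w j)} = 0 := by
    rw [← lintegral_indicator_one hs, lintegral_pi_eq_lintegral_update P i
      (measurable_one.indicator hs)]
    refine (lintegral_congr fun w => ?_).trans lintegral_zero
    rw [← hP (φ (w j)), ← lintegral_indicator_one
      (measurableSet_eq_fun hφ measurable_const)]
    refine lintegral_congr fun v => ?_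
    have : Function.update w i v ∈ {w : Fin n → X | φ (w i) = φ (w j)} ↔
        v ∈ {v | φ v = φ (w j)} := by
      rw [Set.mem_ofPred_eq, Function.update_self, Function.update_of_ne (Ne.symm hij),
        Set.mem_ofPred_eq]
    by_cases h : v ∈ {v | φ v = φ (w j)}
    · rw [Set.indicator_of_mem (this.2 h), Set.indicator_of_mem h]
      rfl
    · rw [Set.indicator_of_notMem (mt this.1 h), Set.indicator_of_notMem h]
  filter_upwards [compl_mem_ae_iff.2 h0] with w hw _ using hw

theorem measurable_sum_weakNeighbors {M : Type*} [PseudoMetricSpace M] [MeasurableSpace M]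
    [OpensMeasurableSpace M] [SecondCountableTopology M] (V : Finset (Fin n)) (k : ℕ)
    {φ : X → M} (hφ : Measurable φ) {h : M → ℝ≥0∞} (hh : Measurable h) (i : Fin n) :
    Measurable fun w : Fin n → X =>
      ∑ j ∈ weakNeighbors V k (fun l => φ (w l)) i, h (φ (w j)) := by
  classical
  have : (fun w : Fin n → X => ∑ j ∈ weakNeighbors V k (fun l => φ (w l)) i, h (φ (w j))) =
      fun w => ∑ j ∈ V, if j ∈ weakNeighbors V k (fun l => φ (w l)) i then h (φ (w j)) else 0 := by
    funext w
    rw [Finset.sum_ite_mem, Finset.inter_eq_right.2 (weakNeighbors_subset _ _ _ _)]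
  rw [this]
  exact Finset.measurable_sum _ fun j _ => Measurable.ite
    (measurableSet_mem_weakNeighbors V k hφ i j) (hh.comp (hφ.comp (measurable_pi_apply j)))
    measurable_const

/-- **Stone's lemma**, in expectation. -/
theorem lintegral_sum_weakNeighbors_le {F : Type*} [NormedAddCommGroup F] [MeasurableSpace F]
    [BorelSpace F] [SecondCountableTopology F] {N : ℕ} {c : F → Fin N}
    (hc : ∀ a b : F, a ≠ 0 → b ≠ 0 → c a = c b → ‖a‖ ≤ ‖b‖ → ‖a - b‖ < ‖b‖)
    {φ : X → F} (hφ : Measurable φ) (hP : ∀ c, P {v | φ v = c} = 0)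
    {h : F → ℝ≥0∞} (hh : Measurable h) {V : Finset (Fin n)} (k : ℕ) {i : Fin n} (hi : i ∈ V) :
    ∫⁻ w, ∑ j ∈ weakNeighbors V k (fun l => φ (w l)) i, h (φ (w j))
        ∂(Measure.pi fun _ : Fin n => P) ≤ ((k * N : ℕ) : ℝ≥0∞) * ∫⁻ v, h (φ v) ∂P := by
  set π : Measure (Fin n → X) := Measure.pi fun _ : Fin n => P
  have hV0 : (V.card : ℝ≥0∞) ≠ 0 := by
    exact_mod_cast (Finset.card_pos.2 ⟨i, hi⟩).ne'
  refine (ENNReal.mul_le_mul_iff_right hV0 (ENNReal.natCast_ne_top _)).1 ?_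
  rw [← lintegral_pi_eq_of_exchangeable P (V := V)
    (fun i w => ∑ j ∈ weakNeighbors V k (fun l => φ (w l)) i, h (φ (w j)))
    (fun i => measurable_sum_weakNeighbors V k hφ hh i) ?_ hi,
    ← lintegral_finsetSum _ fun i _ => measurable_sum_weakNeighbors V k hφ hh i]
  · calc _ ≤ ∫⁻ w, ((k * N : ℕ) : ℝ≥0∞) * ∑ j ∈ V, h (φ (w j)) ∂π := by
          refine lintegral_mono_ae ?_
          filter_upwards [ae_pi_injective P hφ hP] with w hw
          exact sum_sum_weakNeighbors_le hc V k hw fun j => h (φ (w j))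
      _ = _ := by
          have hm : ∀ j, Measurable fun w : Fin n → X => h (φ (w j)) := fun j =>
            hh.comp (hφ.comp (measurable_pi_apply j))
          rw [lintegral_const_mul _ (Finset.measurable_sum _ fun j _ => hm j),
            lintegral_finsetSum _ fun j _ => hm j]
          have : ∀ j ∈ V, ∫⁻ w, h (φ (w j)) ∂π = ∫⁻ v, h (φ v) ∂P := fun j _ =>
            lintegral_pi_eval P j (hh.comp hφ)
          rw [Finset.sum_congr rfl this, Finset.sum_const, nsmul_eq_mul]
          ring
  · intro σ hσ i w
    refine Finset.sum_equiv σ (fun j => mem_weakNeighbors_comp hσ k (fun l => φ (w l)) i j) ?_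
    intro j _
    rfl

/-- By exchangeability the left side is the expected number of sparse points of `V` lying in `B`,
which `card_sparse_le` bounds surely. -/
theorem measure_isSparse_le {M : Type*} [PseudoMetricSpace M] [MeasurableSpace M]
    [OpensMeasurableSpace M] [SecondCountableTopology M] {N : ℕ} {cell : M → Fin N} {B : Set M}
    (hB : MeasurableSet B) {r : ℝ} (hcell : ∀ a ∈ B, ∀ b ∈ B, cell a = cell b → dist a b < r)
    {φ : X → M} (hφ : Measurable φ) {V : Finset (Fin n)} (k : ℕ) {i : Fin n} (hi : i ∈ V) :
    V.card * (Measure.pi fun _ : Fin n => P)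
      {w | φ (w i) ∈ B ∧ IsSparse V k r (fun l => φ (w l)) i} ≤ ((k * N : ℕ) : ℝ≥0∞) := by
  classical
  set π : Measure (Fin n → X) := Measure.pi fun _ : Fin n => P
  have hs : ∀ i, MeasurableSet {w : Fin n → X | φ (w i) ∈ B ∧
      IsSparse V k r (fun l => φ (w l)) i} := fun i =>
    ((hφ.comp (measurable_pi_apply i)) hB).inter (measurableSet_isSparse V k r hφ i)
  have hm : ∀ i, Measurable ({w : Fin n → X | φ (w i) ∈ B ∧
      IsSparse V k r (fun l => φ (w l)) i}.indicator (1 : (Fin n → X) → ℝ≥0∞)) := fun i =>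
    measurable_one.indicator (hs i)
  rw [← lintegral_indicator_one (hs i), ← lintegral_pi_eq_of_exchangeable P (V := V)
    (fun i => {w : Fin n → X | φ (w i) ∈ B ∧
      IsSparse V k r (fun l => φ (w l)) i}.indicator 1) hm ?_ hi,
    ← lintegral_finsetSum _ fun i _ => hm i]
  · calc _ ≤ ∫⁻ _, ((k * N : ℕ) : ℝ≥0∞) ∂π := by
          refine lintegral_mono fun w => ?_
          have := card_sparse_le V k r (fun l => φ (w l)) B cell hcell
          simp only [Set.indicator, Set.mem_ofPred_eq, Pi.one_apply]
          rw [← Finset.sum_filter, Finset.sum_const, nsmul_one]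
          exact_mod_cast this
      _ = _ := by simp [π]
  · intro σ hσ i w
    have : IsSparse V k r (fun l => φ (w (σ l))) i ↔ _ :=
      isSparse_comp hσ k r (fun l => φ (w l)) i
    simp only [Set.indicator, Set.mem_ofPred_eq, Function.comp, Pi.one_apply] at this ⊢
    rw [this]

end Exchangeable

/-! ### The conditional density -/

section Disintegration

variable {d : ℕ} {p : Triple d → ℝ≥0∞}

theorem IsDensity.isProbabilityMeasure (hp : IsDensity p) : IsProbabilityMeasure (jointLaw p) :=
  ⟨by rw [jointLaw, withDensity_apply _ MeasurableSet.univ, setLIntegral_univ,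
    hp.lintegral_eq_one]⟩

theorem lintegral_triple {f : Triple d → ℝ≥0∞} (hf : Measurable f) :
    ∫⁻ w, f w = ∫⁻ x, ∫⁻ y, ∫⁻ z, f (x, y, z) := by
  rw [Measure.volume_eq_prod, lintegral_prod _ hf.aemeasurable]
  refine lintegral_congr fun x => ?_
  rw [Measure.volume_eq_prod, lintegral_prod (fun q : E d × E d => f (x, q))
    (hf.comp measurable_prodMk_left).aemeasurable]

theorem measurable_densXZ (hp : Measurable p) :
    Measurable fun q : E d × E d => densXZ p q.1 q.2 := by
  unfold densXZ
  have h : Measurable fun r : (E d × E d) × E d => p (r.1.1, r.2, r.1.2) := by fun_prop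
  exact h.lintegral_prod_right'

theorem measurable_densXZ_left (hp : Measurable p) (z : E d) :
    Measurable fun x : E d => densXZ p x z :=
  (measurable_densXZ hp).comp measurable_prodMk_right

theorem measurable_densYZ (hp : Measurable p) :
    Measurable fun q : E d × E d => densYZ p q.1 q.2 := by
  unfold densYZ
  have h : Measurable fun r : (E d × E d) × E d => p (r.2, r.1.1, r.1.2) := by fun_prop
  exact h.lintegral_prod_right'

theorem densZ_eq (z : E d) : densZ p z = ∫⁻ x, densXZ p x z := rfl

theorem measurable_densZ (hp : Measurable p) : Measurable (densZ p) := by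
  rw [funext (densZ_eq (p := p))]
  have h : Measurable fun r : E d × E d => densXZ p r.2 r.1 :=
    (measurable_densXZ hp).comp measurable_swap
  exact h.lintegral_prod_right'

theorem measurable_condDensX (hp : Measurable p) :
    Measurable fun q : E d × E d => condDensX p q.1 q.2 :=
  (measurable_densXZ hp).div ((measurable_densZ hp).comp measurable_snd)

theorem lintegral_jointLaw (hp : Measurable p) {f : Triple d → ℝ≥0∞} (hf : Measurable f) :
    ∫⁻ v, f v ∂(jointLaw p) = ∫⁻ x, ∫⁻ y, ∫⁻ z, p (x, y, z) * f (x, y, z) := by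
  rw [jointLaw, lintegral_withDensity_eq_lintegral_mul _ hp hf, lintegral_triple (hp.mul hf)]
  rfl

theorem lintegral_jointLaw_xz (hp : Measurable p) {f : E d × E d → ℝ≥0∞} (hf : Measurable f) :
    ∫⁻ v, f (v.1, v.2.2) ∂(jointLaw p) = ∫⁻ z, ∫⁻ x, densXZ p x z * f (x, z) := by
  rw [lintegral_jointLaw hp (f := fun v => f (v.1, v.2.2)) (by fun_prop)]
  rw [lintegral_lintegral_swap (f := fun z x => densXZ p x z * f (x, z))]
  · refine lintegral_congr fun x => ?_
    rw [lintegral_lintegral_swap (f := fun y z => p (x, y, z) * f (x, z))]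
    · refine lintegral_congr fun z => ?_
      rw [lintegral_mul_const _ (by fun_prop)]
      rfl
    · exact Measurable.aemeasurable (by unfold Function.uncurry; fun_prop)
  · refine Measurable.aemeasurable ?_
    exact ((measurable_densXZ hp).comp measurable_swap).mul (hf.comp measurable_swap)

theorem lintegral_jointLaw_yz (hp : Measurable p) {f : E d × E d → ℝ≥0∞} (hf : Measurable f) :
    ∫⁻ v, f v.2 ∂(jointLaw p) = ∫⁻ y, ∫⁻ z, densYZ p y z * f (y, z) := by
  rw [jointLaw, lintegral_withDensity_eq_lintegral_mul _ hp
      (g := fun v : Triple d => f v.2) (hf.comp measurable_snd),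
    Measure.volume_eq_prod, lintegral_prod_symm _ (by fun_prop), Measure.volume_eq_prod,
    lintegral_prod]
  · refine lintegral_congr fun y => lintegral_congr fun z => ?_
    simp only [Pi.mul_apply]
    rw [lintegral_mul_const _ (by fun_prop)]
    rfl
  · have h : Measurable fun r : (E d × E d) × E d => p (r.2, r.1) * f r.1 := by fun_prop
    exact h.lintegral_prod_right'.aemeasurable

theorem lintegral_jointLaw_z (hp : Measurable p) {f : E d → ℝ≥0∞} (hf : Measurable f) :
    ∫⁻ v, f v.2.2 ∂(jointLaw p) = ∫⁻ z, densZ p z * f z := by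
  rw [lintegral_jointLaw_xz hp (f := fun q => f q.2) (by fun_prop)]
  refine lintegral_congr fun z => ?_
  change ∫⁻ x, densXZ p x z * f z = _
  rw [lintegral_mul_const _ (measurable_densXZ_left hp z)]
  rfl

theorem ae_densZ_ne_top (hp : IsDensity p) : ∀ᵐ z, densZ p z ≠ ∞ := by
  have := hp.isProbabilityMeasure
  have h := lintegral_jointLaw_z hp.measurable (f := fun _ => 1) measurable_const
  simp only [lintegral_const, measure_univ, mul_one] at h
  filter_upwards [ae_lt_top (measurable_densZ hp.measurable) (by rw [← h]; simp)] with z hz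
  exact hz.ne

/-- Places where `p(z)` vanishes carry no mass of the joint law. A statement about `z` may therefore
ignore them, in particular the conventional value of `p(x | z)` there. -/
theorem ae_jointLaw_of_densZ (hp : Measurable p) {s : Set (E d)} (hs : MeasurableSet s)
    (h : ∀ᵐ z, densZ p z ≠ 0 → z ∈ s) : ∀ᵐ v ∂(jointLaw p), v.2.2 ∈ s := by
  rw [ae_iff]
  have hs' : MeasurableSet {v : Triple d | v.2.2 ∉ s} :=
    (hs.compl).preimage (measurable_snd.comp measurable_snd)
  rw [← lintegral_indicator_one hs']
  have := lintegral_jointLaw_z hp (f := sᶜ.indicator 1) (measurable_one.indicator hs.compl)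
  refine Eq.trans ?_ (this.trans ?_)
  · rfl
  · rw [lintegral_eq_zero_iff (f := fun z => densZ p z * sᶜ.indicator 1 z) ((measurable_densZ hp).mul (measurable_one.indicator hs.compl))]
    filter_upwards [h] with z hz
    by_cases h0 : densZ p z = 0
    · simp [h0]
    · simp [hz h0]

theorem ae_lintegral_condDensX (hp : IsDensity p) :
    ∀ᵐ v ∂(jointLaw p), ∫⁻ x, condDensX p x v.2.2 = 1 := by
  have hm : Measurable fun z : E d => ∫⁻ x, condDensX p x z :=
    ((measurable_condDensX hp.measurable).comp measurable_swap).lintegral_prod_right'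
  refine ae_jointLaw_of_densZ hp.measurable (s := {z | ∫⁻ x, condDensX p x z = 1})
    (hm (measurableSet_singleton 1)) ?_
  filter_upwards [ae_densZ_ne_top hp] with z hz h0
  change ∫⁻ x, densXZ p x z / densZ p z = 1
  simp_rw [div_eq_mul_inv]
  rw [lintegral_mul_const _ (measurable_densXZ_left hp.measurable z),
    ← densZ_eq, ENNReal.mul_inv_cancel h0 hz]

theorem jointLaw_z_eq_zero (hd : 0 < d) (p : Triple d → ℝ≥0∞) (c : E d) :
    jointLaw p {v | v.2.2 = c} = 0 := by
  have : Nonempty (Fin d) := ⟨⟨0, hd⟩⟩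
  have : Nontrivial (E d) := inferInstance
  refine withDensity_absolutelyContinuous _ _ ?_
  have : {v : Triple d | v.2.2 = c} = Set.univ ×ˢ (Set.univ ×ˢ {c}) := by
    ext v; simp
  rw [this, Measure.volume_eq_prod, Measure.prod_prod, Measure.volume_eq_prod,
    Measure.prod_prod]
  simp

/-- Drawing `x` afresh from `p(x | z)` does not change the law of `(x, z)`. -/
theorem lintegral_jointLaw_condDensX (hp : IsDensity p) {f : E d × E d → ℝ≥0∞}
    (hf : Measurable f) :
    ∫⁻ v, f (v.1, v.2.2) ∂(jointLaw p) =
      ∫⁻ v, (∫⁻ x, f (x, v.2.2) * condDensX p x v.2.2) ∂(jointLaw p) := by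
  have hκ := measurable_condDensX hp.measurable
  have hm : Measurable fun z : E d => ∫⁻ x, f (x, z) * condDensX p x z :=
    ((hf.mul hκ).comp measurable_swap).lintegral_prod_right'
  rw [lintegral_jointLaw_xz hp.measurable hf, lintegral_jointLaw_z hp.measurable hm]
  refine lintegral_congr_ae ?_
  filter_upwards [ae_densZ_ne_top hp] with z hz
  have hXZ : Measurable fun x => densXZ p x z :=
    (measurable_densXZ hp.measurable).comp measurable_prodMk_right
  rw [← lintegral_const_mul (f := fun x => f (x, z) * condDensX p x z) _ ((hf.mul hκ).comp measurable_prodMk_right)]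
  -- If `p(z) = 0` then `p(x, z) = 0` for almost every `x`, so both sides vanish whatever the
  -- quotient means. Otherwise `p(z)` is finite and nonzero, and cancels.
  by_cases h0 : densZ p z = 0
  · have h1 := h0
    rw [densZ_eq, lintegral_eq_zero_iff hXZ] at h1
    refine lintegral_congr_ae ?_
    filter_upwards [h1] with x hx
    simp only [Pi.zero_apply] at hx
    simp [h0, hx]
  · refine lintegral_congr fun x => ?_
    unfold condDensX
    rw [mul_left_comm, ENNReal.mul_div_cancel h0 hz, mul_comm]

theorem lintegral_prodLaw (hp : IsDensity p) {f : Triple d → ℝ≥0∞} (hf : Measurable f) :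
    ∫⁻ w, f w ∂(prodLaw p) =
      ∫⁻ v, (∫⁻ x, f (x, v.2.1, v.2.2) * condDensX p x v.2.2) ∂(jointLaw p) := by
  have hκ := measurable_condDensX hp.measurable
  have hY := measurable_densYZ hp.measurable
  have hκ' : Measurable fun w : Triple d => condDensX p w.1 w.2.2 :=
    hκ.comp (f := fun w : Triple d => (w.1, w.2.2)) (by fun_prop)
  have hY' : Measurable fun w : Triple d => densYZ p w.2.1 w.2.2 :=
    hY.comp (f := fun w : Triple d => (w.2.1, w.2.2)) (by fun_prop)
  have hκY : Measurable fun w : Triple d => condDensX p w.1 w.2.2 * densYZ p w.2.1 w.2.2 :=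
    hκ'.mul hY'
  have hG : Measurable fun q : E d × E d => ∫⁻ x, f (x, q.1, q.2) * condDensX p x q.2 := by
    have h : Measurable fun r : (E d × E d) × E d =>
        f (r.2, r.1.1, r.1.2) * condDensX p r.2 r.1.2 :=
      (show Measurable fun r : (E d × E d) × E d => f (r.2, r.1.1, r.1.2) by fun_prop).mul
        (hκ.comp (f := fun r : (E d × E d) × E d => (r.2, r.1.2)) (by fun_prop))
    exact h.lintegral_prod_right'
  have h1 := lintegral_jointLaw_yz hp.measurable hG
  simp only [Prod.mk.eta] at h1 ⊢
  rw [h1, prodLaw, lintegral_withDensity_eq_lintegral_mul _ hκY hf,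
    Measure.volume_eq_prod, lintegral_prod_symm _ (hκY.mul hf).aemeasurable,
    Measure.volume_eq_prod, lintegral_prod]
  · refine lintegral_congr fun y => lintegral_congr fun z => ?_
    rw [← lintegral_const_mul]
    · refine lintegral_congr fun x => ?_
      simp only [Pi.mul_apply]
      ring
    · exact (show Measurable fun x => f (x, y, z) by fun_prop).mul
        (hκ.comp measurable_prodMk_right)
  · exact (((hκY.mul hf).comp measurable_swap).lintegral_prod_right').aemeasurable

theorem isProbabilityMeasure_prodLaw (hp : IsDensity p) : IsProbabilityMeasure (prodLaw p) := by
  have := hp.isProbabilityMeasure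
  refine ⟨?_⟩
  rw [← lintegral_one, lintegral_prodLaw hp measurable_const]
  simp_rw [one_mul]
  rw [lintegral_congr_ae (ae_lintegral_condDensX hp)]
  simp

end Disintegration

/-! ### Approximating the conditional density by a continuous function -/

section Approximation

variable {d : ℕ} {p : Triple d → ℝ≥0∞}

/-- The `L¹` distance between the sections `a(·, z)` and `b(·, z')`. -/
noncomputable def sectionDist {d : ℕ} (a b : E d × E d → ℝ≥0∞) (z z' : E d) : ℝ≥0∞ :=
  ∫⁻ x, ((a (x, z) - b (x, z')) + (b (x, z') - a (x, z)))

theorem sectionDist_comm (a b : E d × E d → ℝ≥0∞) (z z' : E d) :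
    sectionDist a b z z' = sectionDist b a z' z :=
  lintegral_congr fun _ => add_comm _ _

theorem measurable_sectionDist {a b : E d × E d → ℝ≥0∞} (ha : Measurable a) (hb : Measurable b) :
    Measurable fun q : E d × E d => sectionDist a b q.1 q.2 := by
  have h : Measurable fun r : (E d × E d) × E d =>
    ((a (r.2, r.1.1) - b (r.2, r.1.2)) + (b (r.2, r.1.2) - a (r.2, r.1.1))) := by fun_prop
  exact h.lintegral_prod_right'

/-- As a function of `(x, z)`, the conditional density has integral one for the product of Lebesgue
measure and the law of `Z`. Continuous functions of compact support are dense in that `L¹` space. -/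
theorem exists_continuous_sectionDist_le (hp : IsDensity p) {δ : ℝ≥0∞} (hδ : δ ≠ 0) :
    ∃ q : E d × E d → ℝ, Continuous q ∧ HasCompactSupport q ∧
      ∫⁻ v, sectionDist (fun a => condDensX p a.1 a.2) (fun a => ENNReal.ofReal (q a))
        v.2.2 v.2.2 ∂(jointLaw p) ≤ δ := by
  have hP := hp.isProbabilityMeasure
  have hz : Measurable fun v : Triple d => v.2.2 := by fun_prop
  set μZ : Measure (E d) := (jointLaw p).map fun v => v.2.2 with hμZ
  have : IsProbabilityMeasure μZ := Measure.isProbabilityMeasure_map hz.aemeasurable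
  set ν : Measure (E d × E d) := (volume : Measure (E d)).prod μZ with hν_def
  have : IsLocallyFiniteMeasure ν := by rw [hν_def]; infer_instance
  have : ν.Regular := inferInstance
  have hκ := measurable_condDensX hp.measurable
  have hν : ∀ f : E d × E d → ℝ≥0∞, Measurable f →
      ∫⁻ a, f a ∂ν = ∫⁻ v, (∫⁻ x, f (x, v.2.2)) ∂(jointLaw p) := by
    intro f hf
    rw [lintegral_prod_symm _ hf.aemeasurable, hμZ, lintegral_map _ hz]
    exact (hf.comp measurable_swap).lintegral_prod_right'
  have h1 : ∫⁻ a, condDensX p a.1 a.2 ∂ν = 1 := by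
    rw [hν _ hκ, lintegral_congr_ae (ae_lintegral_condDensX hp)]
    simp
  have hint : Integrable (fun a : E d × E d => (condDensX p a.1 a.2).toReal) ν :=
    integrable_toReal_of_lintegral_ne_top hκ.aemeasurable (by rw [h1]; simp)
  obtain ⟨q, hqs, hqδ, hqc, -⟩ := hint.exists_hasCompactSupport_lintegral_sub_le
    (ε := δ / 2) (by simpa using hδ)
  refine ⟨q, hqc, hqs, ?_⟩
  have hqm : Measurable fun a => ENNReal.ofReal (q a) := hqc.measurable.ennreal_ofReal
  unfold sectionDist
  rw [← hν (fun a => (condDensX p a.1 a.2 - ENNReal.ofReal (q a)) +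
    (ENNReal.ofReal (q a) - condDensX p a.1 a.2)) ((hκ.sub hqm).add (hqm.sub hκ))]
  -- `sectionDist` adds the two truncated differences and each is at most the absolute difference.
  -- The resulting factor 2 is why the approximation was requested within `δ / 2`.
  calc _ ≤ ∫⁻ a, 2 * ‖(condDensX p a.1 a.2).toReal - q a‖ₑ ∂ν := by
        refine lintegral_mono_ae ?_
        filter_upwards [ae_lt_top hκ (by rw [h1]; simp)] with a ha
        have hc := ENNReal.ofReal_toReal ha.ne
        set c := (condDensX p a.1 a.2).toReal
        rw [← hc, two_mul, Real.enorm_eq_ofReal_abs]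
        refine add_le_add ?_ ?_ <;> rw [tsub_le_iff_right] <;>
          refine le_trans (ENNReal.ofReal_le_ofReal ?_) ENNReal.ofReal_add_le
        · linarith [le_abs_self (c - q a)]
        · linarith [neg_abs_le (c - q a)]
    _ = 2 * ∫⁻ a, ‖(condDensX p a.1 a.2).toReal - q a‖ₑ ∂ν :=
        lintegral_const_mul _ (hκ.ennreal_toReal.sub hqc.measurable).enorm
    _ ≤ 2 * (δ / 2) := by gcongr
    _ ≤ δ := ENNReal.mul_div_le

/-- The sections vanish off the projection `K` of the support, which has finite volume. A uniform
bound `c` on the pointwise difference thus becomes the `L¹` bound `2 c` times that volume, with `c`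
supplied by boundedness or by uniform continuity. -/
theorem sectionDist_continuous {q : E d × E d → ℝ} (hq : Continuous q)
    (hs : HasCompactSupport q) :
    (∃ C : ℝ≥0∞, C ≠ ∞ ∧ ∀ z z', sectionDist (fun a => ENNReal.ofReal (q a))
      (fun a => ENNReal.ofReal (q a)) z z' ≤ C) ∧
    ∀ δ : ℝ≥0∞, δ ≠ 0 → ∃ r > 0, ∀ z z', dist z z' < r → sectionDist
      (fun a => ENNReal.ofReal (q a)) (fun a => ENNReal.ofReal (q a)) z z' ≤ δ := by
  set K : Set (E d) := Prod.fst '' tsupport q with hK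
  have hKc : IsCompact K := IsCompact.image hs continuous_fst
  have hKv : volume K ≠ ∞ := hKc.measure_lt_top.ne
  have h0 : ∀ x ∉ K, ∀ z, q (x, z) = 0 := by
    intro x hx z
    by_contra h
    exact hx ⟨(x, z), subset_tsupport q h, rfl⟩
  have key : ∀ (c : ℝ) (z z' : E d), (∀ x, |q (x, z) - q (x, z')| ≤ c) →
      sectionDist (fun a => ENNReal.ofReal (q a)) (fun a => ENNReal.ofReal (q a)) z z' ≤
        2 * ENNReal.ofReal c * volume K := by
    intro c z z' h
    calc _ ≤ ∫⁻ x, K.indicator (fun _ => 2 * ENNReal.ofReal c) x := by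
          refine lintegral_mono fun x => ?_
          by_cases hx : x ∈ K
          · rw [Set.indicator_of_mem hx, two_mul]
            have := abs_le.1 (h x)
            refine add_le_add ?_ ?_ <;> rw [tsub_le_iff_right] <;>
              refine le_trans (ENNReal.ofReal_le_ofReal ?_) ENNReal.ofReal_add_le
            · linarith
            · linarith
          · rw [Set.indicator_of_notMem hx]
            simp [h0 x hx]
      _ = _ := by rw [lintegral_indicator_const hKc.measurableSet]
  constructor
  · obtain ⟨c, hc⟩ := hs.exists_bound_of_continuous hq
    refine ⟨2 * ENNReal.ofReal (2 * c) * volume K,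
      ENNReal.mul_ne_top (ENNReal.mul_ne_top ENNReal.ofNat_ne_top ENNReal.ofReal_ne_top) hKv, fun z z' => key _ z z' ?_⟩
    intro x
    have h1 := abs_le.1 (hc (x, z))
    have h2 := abs_le.1 (hc (x, z'))
    rw [abs_le]
    constructor <;> linarith
  · intro δ hδ
    obtain ⟨c, hc0, hc⟩ : ∃ c : ℝ, 0 < c ∧ 2 * ENNReal.ofReal c * volume K ≤ δ := by
      -- Adding one avoids a zero denominator when `K` is null.
      have h2 : δ / (2 * volume K + 1) ≠ 0 :=
        ENNReal.div_ne_zero.2 ⟨hδ, by simp [ENNReal.mul_eq_top, hKv]⟩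
      obtain ⟨c, hc0, hc⟩ := ENNReal.lt_iff_exists_nnreal_btwn.1 (pos_iff_ne_zero.2 h2)
      refine ⟨c, by exact_mod_cast hc0, ?_⟩
      rw [ENNReal.ofReal_coe_nnreal, mul_right_comm]
      calc 2 * volume K * (c : ℝ≥0∞) ≤ (2 * volume K + 1) * (δ / (2 * volume K + 1)) :=
            mul_le_mul' le_self_add hc.le
        _ ≤ δ := ENNReal.mul_div_le
    have hu := hs.uniformContinuous_of_continuous hq
    obtain ⟨r, hr, h⟩ := Metric.uniformContinuous_iff.1 hu c hc0
    refine ⟨r, hr, fun z z' hzz => (key c z z' fun x => ?_).trans hc⟩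
    have : dist (x, z) (x, z') < r := by
      rw [Prod.dist_eq]; simpa using hzz
    exact (h this).le

theorem lintegral_mul_section_le {a b : E d × E d → ℝ≥0∞} (ha : Measurable a) (hb : Measurable b)
    {f : E d → ℝ≥0∞} (hf : Measurable f) {M : ℝ≥0∞} (hM : ∀ x, f x ≤ M)
    (hMt : M ≠ ∞) (z z' : E d) :
    ∫⁻ x, f x * a (x, z) ≤ (∫⁻ x, f x * b (x, z')) + M * sectionDist a b z z' := by
  have hd : Measurable fun x => ((a (x, z) - b (x, z')) + (b (x, z') - a (x, z))) := by fun_prop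
  unfold sectionDist
  rw [← lintegral_const_mul' _ _ hMt, ← lintegral_add_left (by fun_prop)]
  refine lintegral_mono fun x => ?_
  calc f x * a (x, z) ≤ f x * (b (x, z') + (a (x, z) - b (x, z'))) := by
        gcongr; exact le_add_tsub
    _ ≤ f x * b (x, z') + M * ((a (x, z) - b (x, z')) + (b (x, z') - a (x, z))) := by
        rw [mul_add]
        gcongr
        · exact hM x
        · exact le_self_add

/-- Triangle inequality through `q`: replace `p(x | z)` by `q` at `z`, move `q` from `z` to `z'`,
and return to `p(x | z')`. Each change costs at most `M` times an `L¹` distance. -/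
theorem lintegral_mul_condDensX_le (hp : IsDensity p) {q : E d × E d → ℝ≥0∞} (hq : Measurable q)
    {f : E d → ℝ≥0∞} (hf : Measurable f) {M : ℝ≥0∞} (hM : ∀ x, f x ≤ M) (hMt : M ≠ ∞)
    (z z' : E d) :
    ∫⁻ x, f x * condDensX p x z ≤ (∫⁻ x, f x * condDensX p x z') +
      M * (sectionDist (fun a => condDensX p a.1 a.2) q z z +
        sectionDist (fun a => condDensX p a.1 a.2) q z' z' + sectionDist q q z z') := by
  have hκ := measurable_condDensX hp.measurable
  have h1 := lintegral_mul_section_le hκ hq hf hM hMt z z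
  have h2 := lintegral_mul_section_le hq hq hf hM hMt z z'
  have h3 := lintegral_mul_section_le hq hκ hf hM hMt z' z'
  rw [sectionDist_comm] at h3
  calc _ ≤ _ := h1
    _ ≤ ((∫⁻ x, f x * condDensX p x z') + M * sectionDist (fun a => condDensX p a.1 a.2) q z' z')
        + M * sectionDist q q z z' + M * sectionDist (fun a => condDensX p a.1 a.2) q z z := by
        gcongr
        exact h2.trans (by gcongr)
    _ = _ := by ring

end Approximation

/-! ### Consistency of the nearest neighbor average -/

section Bias

variable {d n : ℕ} {p : Triple d → ℝ≥0∞}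

theorem sum_isolatedNeighbors_eq {A : Type*} [AddCommMonoid A] (I : Finset (Fin n)) (k : ℕ)
    (z : Fin n → E d) (ζ : E d) (F : Fin n → A)
    [∀ j, Decidable (j ∈ isolatedNeighbors I k z ζ)] :
    ∑ j ∈ isolatedNeighbors I k z ζ, F j =
      ∑ j ∈ Iᶜ, if j ∈ isolatedNeighbors I k z ζ then F j else 0 := by
  rw [← Finset.sum_filter]
  congr 1
  ext j
  rw [Finset.mem_filter]
  exact ⟨fun h => ⟨isolatedNeighbors_subset _ _ _ _ h, h⟩, fun h => h.2⟩

theorem measurable_sum_isolatedNeighbors {A : Type*} [AddCommMonoid A] [MeasurableSpace A]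
    [MeasurableAdd₂ A] (I : Finset (Fin n)) (k : ℕ) (i : Fin n)
    {F : Fin n → (Fin n → Triple d) → A} (hF : ∀ j, Measurable (F j)) :
    Measurable fun w : Fin n → Triple d =>
      ∑ j ∈ isolatedNeighbors I k (fun l => (w l).2.2) (w i).2.2, F j w := by
  classical
  simp_rw [sum_isolatedNeighbors_eq]
  exact Finset.measurable_sum _ fun j _ => Measurable.ite
    (measurableSet_mem_isolatedNeighbors I k (φ := fun v : Triple d => v.2.2) (by fun_prop) i j)
    (hF j) measurable_const

theorem measurable_lintegral_mul_condDensX (hp : Measurable p) {f : Triple d → ℝ≥0∞}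
    (hf : Measurable f) :
    Measurable fun r : (E d × E d) × E d => ∫⁻ x, f (x, r.1) * condDensX p x r.2 := by
  have h : Measurable fun r : ((E d × E d) × E d) × E d =>
      f (r.2, r.1.1) * condDensX p r.2 r.1.2 :=
    (show Measurable fun r : ((E d × E d) × E d) × E d => f (r.2, r.1.1) by fun_prop).mul
      ((measurable_condDensX hp).comp
        (f := fun r : ((E d × E d) × E d) × E d => (r.2, r.1.2)) (by fun_prop))
  exact h.lintegral_prod_right'

/-- Given the points `z`, the variables `x` are drawn from the conditional densities. -/
theorem lintegral_sum_isolatedNeighbors (hp : IsDensity p) {f : Triple d → ℝ≥0∞}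
    (hf : Measurable f) (I : Finset (Fin n)) (k : ℕ) {i : Fin n} (hi : i ∈ I) :
    ∫⁻ w, (∑ j ∈ isolatedNeighbors I k (fun l => (w l).2.2) (w i).2.2, f ((w j).1, (w i).2))
        ∂(Measure.pi fun _ : Fin n => jointLaw p) =
      ∫⁻ w, (∑ j ∈ isolatedNeighbors I k (fun l => (w l).2.2) (w i).2.2,
        ∫⁻ x, f (x, (w i).2) * condDensX p x (w j).2.2)
        ∂(Measure.pi fun _ : Fin n => jointLaw p) := by
  classical
  have := hp.isProbabilityMeasure
  have hz : Measurable fun v : Triple d => v.2.2 := by fun_prop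
  have hG := measurable_lintegral_mul_condDensX hp.measurable hf
  have hm1 : ∀ j, Measurable fun w : Fin n → Triple d => f ((w j).1, (w i).2) := fun j => by
    fun_prop
  have hm2 : ∀ j, Measurable fun w : Fin n → Triple d =>
      ∫⁻ x, f (x, (w i).2) * condDensX p x (w j).2.2 := fun j =>
    hG.comp (f := fun w : Fin n → Triple d => ((w i).2, (w j).2.2)) (by fun_prop)
  have hs := measurableSet_mem_isolatedNeighbors (n := n) I k hz i
  simp_rw [sum_isolatedNeighbors_eq]
  rw [lintegral_finsetSum _ fun j _ => Measurable.ite (hs j) (hm1 j) measurable_const,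
    lintegral_finsetSum _ fun j _ => Measurable.ite (hs j) (hm2 j) measurable_const]
  refine Finset.sum_congr rfl fun j hj => ?_
  have hij : i ≠ j := by rintro rfl; exact (Finset.mem_compl.1 hj) hi
  rw [lintegral_pi_eq_lintegral_update _ j (Measurable.ite (hs j) (hm1 j) measurable_const),
    lintegral_pi_eq_lintegral_update _ j (Measurable.ite (hs j) (hm2 j) measurable_const)]
  refine lintegral_congr fun w => ?_
  have hupd : ∀ v : Triple d, (fun l => (Function.update w j v l).2.2) =
      Function.update (fun l => (w l).2.2) j v.2.2 := by
    intro v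
    funext l
    rcases eq_or_ne l j with rfl | h
    · simp
    · simp [h]
  simp_rw [hupd, Function.update_self, Function.update_of_ne hij]
  have hcs : MeasurableSet {ζ : E d | j ∈ isolatedNeighbors I k
      (Function.update (fun l => (w l).2.2) j ζ) (w i).2.2} := by
    have h := (measurableSet_mem_isolatedNeighbors (n := n) I k (φ := fun ζ : E d => ζ)
      measurable_id i j).preimage (measurable_update (fun l => (w l).2.2) (a := j))
    simpa [Function.update_of_ne hij] using h
  -- With the other coordinates fixed, membership of `j` depends on the resampled triple only
  -- through its `z` component. Hence `x` may be redrawn from `p(x | z)` without affecting the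
  -- selection.
  have key := lintegral_jointLaw_condDensX hp (f := fun a : E d × E d =>
    if j ∈ isolatedNeighbors I k (Function.update (fun l => (w l).2.2) j a.2) (w i).2.2
      then f (a.1, (w i).2) else 0)
    (Measurable.ite (hcs.preimage measurable_snd) (by fun_prop) measurable_const)
  simp only at key
  rw [key]
  refine lintegral_congr fun v => ?_
  split_ifs <;> simp

theorem exists_mul_le {a η : ℝ≥0∞} (ha : a ≠ ∞) (hη : η ≠ 0) :
    ∃ s : ℝ≥0∞, s ≠ 0 ∧ s ≠ ∞ ∧ a * s ≤ η := by
  refine ⟨min (η / (a + 1)) 1, ?_, ?_, ?_⟩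
  · have := ENNReal.div_ne_zero.2 ⟨hη, ENNReal.add_ne_top.2 ⟨ha, ENNReal.one_ne_top⟩⟩
    simp [min_eq_iff, this]
  · exact ne_top_of_le_ne_top ENNReal.one_ne_top (min_le_right _ _)
  · calc a * min (η / (a + 1)) 1 ≤ (a + 1) * (η / (a + 1)) :=
          mul_le_mul' le_self_add (min_le_left _ _)
      _ ≤ η := ENNReal.mul_div_le

/-- The mean distance, in `L¹`, between the conditional densities at a point and at its nearest
neighbors, up to an approximation by a function `q`. -/
theorem exists_sum_sectionDist_le (hd : 0 < d) (hp : IsDensity p) {η : ℝ≥0∞} (hη : η ≠ 0) :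
    ∃ q : E d × E d → ℝ≥0∞, Measurable q ∧ ∃ ρ : ℝ≥0∞, ρ ≠ 0 ∧ ρ ≠ ∞ ∧
      ∀ (n : ℕ) (I : Finset (Fin n)) (k : ℕ) (i : Fin n), i ∈ I → k ≤ Iᶜ.card →
        (k : ℝ≥0∞) ≤ ρ * Iᶜ.card →
        ∫⁻ w, (∑ j ∈ isolatedNeighbors I k (fun l => (w l).2.2) (w i).2.2,
          (sectionDist (fun a => condDensX p a.1 a.2) q (w j).2.2 (w j).2.2 +
            sectionDist (fun a => condDensX p a.1 a.2) q (w i).2.2 (w i).2.2 +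
            sectionDist q q (w j).2.2 (w i).2.2)) ∂(Measure.pi fun _ : Fin n => jointLaw p)
          ≤ k * η := by
  classical
  have hP := hp.isProbabilityMeasure
  have hz : Measurable fun v : Triple d => v.2.2 := by fun_prop
  obtain ⟨N, c, hc⟩ := exists_narrow_cones (E d)
  -- The final estimate is `k` times `N + 5` copies of `s`: `N + 1` from Stone's lemma, and one each
  -- from the error at `Z i`, from close neighbors, from sparse points in `K`, and from points
  -- outside `K`.
  obtain ⟨s, hs0, hst, hs⟩ := exists_mul_le (a := ((N + 5 : ℕ) : ℝ≥0∞)) (η := η)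
    (ENNReal.natCast_ne_top _) hη
  obtain ⟨q₀, hqc, hqs, hqs'⟩ := exists_continuous_sectionDist_le hp hs0
  obtain ⟨⟨C, hCt, hC⟩, hmod⟩ := sectionDist_continuous hqc hqs
  obtain ⟨r, hr, hqr⟩ := hmod s hs0
  set q : E d × E d → ℝ≥0∞ := fun a => ENNReal.ofReal (q₀ a) with hq
  have hqm : Measurable q := hqc.measurable.ennreal_ofReal
  obtain ⟨β, hβ0, -, hβ⟩ := exists_mul_le hCt hs0
  have hμZ : IsProbabilityMeasure ((jointLaw p).map fun v => v.2.2) :=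
    Measure.isProbabilityMeasure_map hz.aemeasurable
  obtain ⟨K, hKc, hK⟩ := isTightMeasureSet_iff_exists_isCompact_measure_compl_le.1
    (isTightMeasureSet_singleton (μ := (jointLaw p).map fun v => v.2.2)) β
      (pos_iff_ne_zero.2 hβ0)
  have hK' : jointLaw p {v | v.2.2 ∉ K} ≤ β := by
    have := hK _ rfl
    rwa [Measure.map_apply hz hKc.measurableSet.compl] at this
  obtain ⟨L, cell, hcell⟩ := exists_cells hKc.totallyBounded hr
  -- A point in `K` is sparse with probability at most `k (L + 1) / V.card`, so this `ρ` makes the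
  -- cost `C` of that event at most `s`.
  obtain ⟨ρ, hρ0, hρt, hρ⟩ := exists_mul_le (a := C * ((L + 1 : ℕ) : ℝ≥0∞)) (η := s)
    (ENNReal.mul_ne_top hCt (ENNReal.natCast_ne_top _)) hs0
  refine ⟨q, hqm, ρ, hρ0, hρt, fun n I k i hi hk hkρ => ?_⟩
  set π : Measure (Fin n → Triple d) := Measure.pi fun _ : Fin n => jointLaw p with hπ
  set H : E d → ℝ≥0∞ := fun z => sectionDist (fun a => condDensX p a.1 a.2) q z z with hH
  have hHm : Measurable H :=
    (measurable_sectionDist (measurable_condDensX hp.measurable) hqm).comp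
      (f := fun z : E d => (z, z)) (by fun_prop)
  -- The neighbors of `Z i` are sought outside `I`; adding `i` gives a set of indices over which the
  -- configuration is exchangeable.
  set V := insert i Iᶜ with hV
  have hiV : i ∈ V := Finset.mem_insert_self _ _
  set S : Set (Fin n → Triple d) := {w | (w i).2.2 ∈ K ∧ IsSparse V k r (fun l => (w l).2.2) i}
    with hS
  set S' : Set (Fin n → Triple d) := {w | (w i).2.2 ∉ K} with hS'
  have hKm : MeasurableSet {w : Fin n → Triple d | (w i).2.2 ∈ K} :=
    hKc.measurableSet.preimage (hz.comp (measurable_pi_apply i))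
  have hSm : MeasurableSet S := hKm.inter (measurableSet_isSparse V k r hz i)
  have hS'm : MeasurableSet S' := hKm.compl
  have hpt : ∀ w : Fin n → Triple d,
      ∑ j ∈ isolatedNeighbors I k (fun l => (w l).2.2) (w i).2.2,
        (H (w j).2.2 + H (w i).2.2 + sectionDist q q (w j).2.2 (w i).2.2) ≤
      ∑ j ∈ weakNeighbors V k (fun l => (w l).2.2) i, H (w j).2.2 +
        (k * H (w i).2.2 + (k * s + (k * C * S.indicator 1 w + k * C * S'.indicator 1 w))) := by
    intro w
    have hcard := card_isolatedNeighbors I (fun l => (w l).2.2) (w i).2.2 hk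
    have hsub := isolatedNeighbors_subset_weakNeighbors I k (fun l => (w l).2.2) hi
    rw [Finset.sum_add_distrib, Finset.sum_add_distrib, Finset.sum_const, hcard, nsmul_eq_mul,
      add_assoc]
    refine add_le_add (Finset.sum_le_sum_of_subset hsub) (add_le_add le_rfl ?_)
    -- On the bad events the crude bound `C` applies to each of the `k` terms. Off them `Z i` is not
    -- sparse, so all its neighbors are within `r`.
    by_cases hw : w ∈ S ∪ S'
    · have h1 : (1 : ℝ≥0∞) ≤ S.indicator 1 w + S'.indicator 1 w := by
        rcases hw with hw | hw
        · rw [Set.indicator_of_mem hw]; exact le_self_add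
        · rw [Set.indicator_of_mem hw]; exact le_add_self
      calc _ ≤ ∑ _j ∈ isolatedNeighbors I k (fun l => (w l).2.2) (w i).2.2, C :=
            Finset.sum_le_sum fun j _ => hC _ _
        _ = k * C * 1 := by rw [Finset.sum_const, hcard, nsmul_eq_mul, mul_one]
        _ ≤ k * C * (S.indicator 1 w + S'.indicator 1 w) := by gcongr
        _ ≤ _ := by rw [mul_add]; exact le_add_self
    · have hwS : ¬ IsSparse V k r (fun l => (w l).2.2) i := by
        intro h
        by_cases hwK : (w i).2.2 ∈ K
        · exact hw (Or.inl ⟨hwK, h⟩)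
        · exact hw (Or.inr hwK)
      calc _ ≤ ∑ _j ∈ isolatedNeighbors I k (fun l => (w l).2.2) (w i).2.2, s :=
            Finset.sum_le_sum fun j hj => hqr _ _ (dist_lt_of_mem_weakNeighbors hwS (hsub hj))
        _ = k * s := by rw [Finset.sum_const, hcard, nsmul_eq_mul]
        _ ≤ _ := le_self_add
  have hHi : ∫⁻ w, H (w i).2.2 ∂π ≤ s := by
    rw [lintegral_pi_eval (jointLaw p) i (f := fun v => H v.2.2) (hHm.comp hz)]
    exact hqs'
  have hwk : ∫⁻ w, ∑ j ∈ weakNeighbors V k (fun l => (w l).2.2) i, H (w j).2.2 ∂π ≤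
      ((k * (N + 1) : ℕ) : ℝ≥0∞) * s :=
    (lintegral_sum_weakNeighbors_le (jointLaw p) hc hz (jointLaw_z_eq_zero hd p) hHm k hiV).trans
      (by gcongr)
  have hπS : k * C * π S ≤ k * s := by
    have h1 := measure_isSparse_le (jointLaw p) hKc.measurableSet hcell hz k hiV
    have hVc : Iᶜ.card ≤ V.card := Finset.card_le_card (Finset.subset_insert _ _)
    have hV0 : (V.card : ℝ≥0∞) ≠ 0 := by exact_mod_cast (Finset.card_pos.2 ⟨i, hiV⟩).ne'
    rw [mul_assoc]
    gcongr
    refine (ENNReal.mul_le_mul_iff_right hV0 (ENNReal.natCast_ne_top _)).1 ?_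
    calc (V.card : ℝ≥0∞) * (C * π S) = C * (V.card * π S) := by ring
      _ ≤ C * ((k * (L + 1) : ℕ) : ℝ≥0∞) := by gcongr
      _ = C * ((L + 1 : ℕ) : ℝ≥0∞) * k := by push_cast; ring
      _ ≤ C * ((L + 1 : ℕ) : ℝ≥0∞) * (ρ * Iᶜ.card) := by gcongr
      _ = (C * ((L + 1 : ℕ) : ℝ≥0∞) * ρ) * Iᶜ.card := by ring
      _ ≤ s * V.card := by gcongr
      _ = _ := mul_comm _ _
  have hπS' : k * C * π S' ≤ k * s := by
    have h1 : π S' ≤ β := by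
      rw [← lintegral_indicator_one hS'm]
      refine le_trans (le_of_eq ?_) hK'
      have hm : MeasurableSet {v : Triple d | v.2.2 ∉ K} := (hKc.measurableSet.preimage hz).compl
      rw [← lintegral_indicator_one hm, ← lintegral_pi_eval (n := n) (jointLaw p) i
        (measurable_one.indicator hm)]
      rfl
    rw [mul_assoc]
    gcongr
    exact (mul_le_mul' le_rfl h1).trans hβ
  have hind : ∀ {A : Set (Fin n → Triple d)}, MeasurableSet A →
      ∫⁻ w, k * C * A.indicator 1 w ∂π = k * C * π A := by
    intro A hA
    rw [lintegral_const_mul _ (measurable_one.indicator hA), lintegral_indicator_one hA]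
  have hm1 : Measurable fun w : Fin n → Triple d => (k : ℝ≥0∞) * H (w i).2.2 :=
    (hHm.comp (hz.comp (measurable_pi_apply i))).const_mul _
  have hm2 : Measurable fun w : Fin n → Triple d => (k : ℝ≥0∞) * C * S.indicator 1 w :=
    (measurable_one.indicator hSm).const_mul _
  calc _ ≤ ∫⁻ w, (∑ j ∈ weakNeighbors V k (fun l => (w l).2.2) i, H (w j).2.2 +
        (k * H (w i).2.2 + (k * s + (k * C * S.indicator 1 w + k * C * S'.indicator 1 w)))) ∂π :=
        lintegral_mono hpt
    _ = ∫⁻ w, ∑ j ∈ weakNeighbors V k (fun l => (w l).2.2) i, H (w j).2.2 ∂π +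
        (k * ∫⁻ w, H (w i).2.2 ∂π + (k * s + (k * C * π S + k * C * π S'))) := by
        rw [lintegral_add_left (measurable_sum_weakNeighbors V k hz hHm i),
          lintegral_add_left hm1, lintegral_add_left measurable_const, lintegral_add_left hm2,
          hind hSm, hind hS'm, lintegral_const_mul' _ _ (ENNReal.natCast_ne_top _)]
        simp [hπ]
    _ ≤ ((k * (N + 1) : ℕ) : ℝ≥0∞) * s + (k * s + (k * s + (k * s + k * s))) := by
        gcongr
    _ = k * (((N + 5 : ℕ) : ℝ≥0∞) * s) := by push_cast; ring
    _ ≤ k * η := by gcongr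

/-- The mean loss over the nearest neighbors converges to the mean loss under the product law. -/
theorem exists_lintegral_sum_isolatedNeighbors_close (hd : 0 < d) (hp : IsDensity p)
    {f : Triple d → ℝ≥0∞} (hf : Measurable f) {M : ℝ≥0∞} (hM : ∀ w, f w ≤ M) (hMt : M ≠ ∞)
    {η : ℝ≥0∞} (hη : η ≠ 0) :
    ∃ ρ : ℝ≥0∞, ρ ≠ 0 ∧ ρ ≠ ∞ ∧
      ∀ (n : ℕ) (I : Finset (Fin n)) (k : ℕ) (i : Fin n), i ∈ I → k ≤ Iᶜ.card →
        (k : ℝ≥0∞) ≤ ρ * Iᶜ.card →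
        ∫⁻ w, (∑ j ∈ isolatedNeighbors I k (fun l => (w l).2.2) (w i).2.2, f ((w j).1, (w i).2))
          ∂(Measure.pi fun _ : Fin n => jointLaw p) ≤ k * ∫⁻ w, f w ∂(prodLaw p) + k * η ∧
        k * ∫⁻ w, f w ∂(prodLaw p) ≤
          ∫⁻ w, (∑ j ∈ isolatedNeighbors I k (fun l => (w l).2.2) (w i).2.2, f ((w j).1, (w i).2))
          ∂(Measure.pi fun _ : Fin n => jointLaw p) + k * η := by
  have hP := hp.isProbabilityMeasure
  obtain ⟨s, hs0, -, hs⟩ := exists_mul_le hMt hη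
  obtain ⟨q, hqm, ρ, hρ0, hρt, hρ⟩ := exists_sum_sectionDist_le hd hp hs0
  refine ⟨ρ, hρ0, hρt, fun n I k i hi hk hkρ => ?_⟩
  set π : Measure (Fin n → Triple d) := Measure.pi fun _ : Fin n => jointLaw p with hπ
  have hG := measurable_lintegral_mul_condDensX hp.measurable hf
  set G : (E d × E d) → E d → ℝ≥0∞ := fun a z => ∫⁻ x, f (x, a) * condDensX p x z with hGdef
  set R : (Fin n → Triple d) → Fin n → ℝ≥0∞ := fun w j =>
    sectionDist (fun a => condDensX p a.1 a.2) q (w j).2.2 (w j).2.2 +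
            sectionDist (fun a => condDensX p a.1 a.2) q (w i).2.2 (w i).2.2 +
            sectionDist q q (w j).2.2 (w i).2.2 with hR
  set A : (Fin n → Triple d) → Finset (Fin n) := fun w =>
    isolatedNeighbors I k (fun l => (w l).2.2) (w i).2.2 with hA
  have hcard : ∀ w, (A w).card = k := fun w => card_isolatedNeighbors I _ _ hk
  have hGm : ∀ j, Measurable fun w : Fin n → Triple d => G (w i).2 (w j).2.2 := fun j =>
    hG.comp (f := fun w : Fin n → Triple d => ((w i).2, (w j).2.2)) (by fun_prop)
  have hRi : ∫⁻ w, M * ∑ j ∈ A w, R w j ∂π ≤ k * η := by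
    rw [lintegral_const_mul' _ _ hMt]
    calc _ ≤ M * (k * s) := by gcongr; exact hρ n I k i hi hk hkρ
      _ = k * (M * s) := by ring
      _ ≤ k * η := by gcongr
  have h0 : ∫⁻ w, ∑ _j ∈ A w, G (w i).2 (w i).2.2 ∂π = k * ∫⁻ w, f w ∂(prodLaw p) := by
    rw [lintegral_prodLaw hp hf]
    simp_rw [Finset.sum_const, hcard, nsmul_eq_mul]
    rw [lintegral_const_mul _ (hGm i), lintegral_pi_eval (jointLaw p) i
      (f := fun v => G v.2 v.2.2)
      (hG.comp (f := fun v : Triple d => (v.2, v.2.2)) (by fun_prop))]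
  rw [lintegral_sum_isolatedNeighbors hp hf I k hi, ← h0]
  have hle : ∀ w j, G (w i).2 (w j).2.2 ≤ G (w i).2 (w i).2.2 + M * R w j := fun w j =>
    lintegral_mul_condDensX_le hp hqm (f := fun x => f (x, (w i).2)) (by fun_prop)
      (fun x => hM _) hMt _ _
  have hge : ∀ w j, G (w i).2 (w i).2.2 ≤ G (w i).2 (w j).2.2 + M * R w j := fun w j => by
    have := lintegral_mul_condDensX_le hp hqm (f := fun x => f (x, (w i).2)) (by fun_prop)
      (fun x => hM _) hMt (w i).2.2 (w j).2.2
    rw [sectionDist_comm q q, add_comm (sectionDist _ q (w i).2.2 (w i).2.2)] at this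
    exact this
  constructor
  · calc _ ≤ ∫⁻ w, (∑ _j ∈ A w, G (w i).2 (w i).2.2 + M * ∑ j ∈ A w, R w j) ∂π := by
          refine lintegral_mono fun w => ?_
          rw [Finset.mul_sum, ← Finset.sum_add_distrib]
          exact Finset.sum_le_sum fun j _ => hle w j
      _ = ∫⁻ w, ∑ _j ∈ A w, G (w i).2 (w i).2.2 ∂π + ∫⁻ w, M * ∑ j ∈ A w, R w j ∂π :=
          lintegral_add_left (measurable_sum_isolatedNeighbors I k i fun _ => hGm i) _
      _ ≤ _ := by gcongr
  · calc _ ≤ ∫⁻ w, (∑ j ∈ A w, G (w i).2 (w j).2.2 + M * ∑ j ∈ A w, R w j) ∂π := by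
          refine lintegral_mono fun w => ?_
          rw [Finset.mul_sum, ← Finset.sum_add_distrib]
          exact Finset.sum_le_sum fun j _ => hge w j
      _ = ∫⁻ w, ∑ j ∈ A w, G (w i).2 (w j).2.2 ∂π + ∫⁻ w, M * ∑ j ∈ A w, R w j ∂π :=
          lintegral_add_left (measurable_sum_isolatedNeighbors I k i hGm) _
      _ ≤ _ := by gcongr

end Bias

/-! ### Concentration of the two parts of the empirical loss -/

section Concentration

variable {d n : ℕ}

/-- The sum of the values of `h` over the product batch. -/
noncomputable def prodBatchSum (k : ℕ) (I : Finset (Fin n)) (h : Triple d → ℝ)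
    (w : Fin n → Triple d) : ℝ :=
  ∑ i ∈ I, ∑ j ∈ isolatedNeighbors I k (fun l => (w l).2.2) (w i).2.2, h ((w j).1, (w i).2)

theorem prodBatchLoss_eq (m k : ℕ) (I : Finset (Fin n)) (w : Fin n → Triple d)
    (ω : Triple d → ℝ) : prodBatchLoss m k I w ω =
      (1 / ((m * k : ℕ) : ℝ)) * prodBatchSum k I (fun v => -Real.log (1 - ω v)) w := by
  unfold prodBatchLoss prodBatchSum
  simp only [Finset.sum_neg_distrib, mul_neg]

theorem measurable_prodBatchSum (k : ℕ) (I : Finset (Fin n)) {h : Triple d → ℝ}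
    (hh : Measurable h) : Measurable (prodBatchSum k I h) := by
  unfold prodBatchSum
  exact Finset.measurable_sum _ fun i _ => measurable_sum_isolatedNeighbors I k i
    (F := fun j w => h ((w j).1, (w i).2)) fun j => by fun_prop

theorem abs_sum_sub_sum_le {ι : Type*} {A A' : Finset ι} {k : ℕ} (hA : A.card = k)
    (hA' : A'.card = k) {g g' : ι → ℝ} {a C : ℝ} (hg : ∀ l, g l ∈ Set.Icc a (a + C))
    (hg' : ∀ l, g' l ∈ Set.Icc a (a + C)) :
    |∑ j ∈ A, g j - ∑ j ∈ A', g' j| ≤ k * C := by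
  have h : ∀ (B : Finset ι) (f : ι → ℝ), B.card = k → (∀ l, f l ∈ Set.Icc a (a + C)) →
      ∑ j ∈ B, f j ∈ Set.Icc (k * a) (k * (a + C)) := by
    intro B f hB hf
    have h1 := Finset.card_nsmul_le_sum B f a fun j _ => (hf j).1
    have h2 := Finset.sum_le_card_nsmul B f (a + C) fun j _ => (hf j).2
    rw [hB, nsmul_eq_mul] at h1 h2
    exact ⟨h1, h2⟩
  have h1 := h A g hA hg
  have h2 := h A' g' hA' hg'
  have h3 := h1.1
  have h4 := h1.2
  have h5 := h2.1
  have h6 := h2.2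
  rw [abs_le]
  constructor <;> linarith

/-- If `r ∈ I`, only the inner sum at `i = r` changes: its neighbors may be entirely different, but
the cost is at most `k * C ≤ m * C`. If `r ∉ I`, each of the `m` inner sums exchanges at most one
neighbor, at cost `C`. -/
theorem abs_prodBatchSum_update_sub_le {k m : ℕ} {I : Finset (Fin n)} (hI : I.card = m)
    (hk0 : 0 < k) (hkm : k ≤ m) (hk : k ≤ Iᶜ.card) {h : Triple d → ℝ} {a C : ℝ}
    (hh : ∀ v, h v ∈ Set.Icc a (a + C)) (w : Fin n → Triple d) (r : Fin n) (v : Triple d) :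
    |prodBatchSum k I h (Function.update w r v) - prodBatchSum k I h w| ≤ m * C := by
  classical
  have hC : 0 ≤ C := by have := hh v; linarith [this.1.trans this.2]
  have hne : ∀ l, l ≠ r → Function.update w r v l = w l := fun l hl => Function.update_of_ne hl _ _
  unfold prodBatchSum
  rw [← Finset.sum_sub_distrib]
  refine (Finset.abs_sum_le_sum_abs _ _).trans ?_
  by_cases hr : r ∈ I
  · rw [Finset.sum_eq_single_of_mem r hr]
    · refine (abs_sum_sub_sum_le (card_isolatedNeighbors I _ _ hk) (card_isolatedNeighbors I _ _ hk)
        (g := fun j => h ((Function.update w r v j).1, (Function.update w r v r).2))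
        (g' := fun j => h ((w j).1, (w r).2)) (fun _ => hh _) (fun _ => hh _)).trans ?_
      gcongr
    · intro i hi hir
      rw [hne i hir, isolatedNeighbors_congr k (z' := fun l => (w l).2.2) _ fun l hl => by
        rw [hne l (by rintro rfl; exact hl hr)]]
      rw [abs_eq_zero, sub_eq_zero]
      refine Finset.sum_congr rfl fun j hj => ?_
      have hjr : j ≠ r := by
        rintro rfl
        exact Finset.mem_compl.1 (isolatedNeighbors_subset _ _ _ _ hj) hr
      rw [hne j hjr]
  · rw [← hI, ← nsmul_eq_mul]
    refine Finset.sum_le_card_nsmul _ _ _ fun i hi => ?_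
    have hir : i ≠ r := by rintro rfl; exact hr hi
    rw [hne i hir]
    refine abs_sum_isolatedNeighbors_sub_le I hk0 hk r (w i).2.2
      (g := fun j => h ((Function.update w r v j).1, (w i).2))
      (g' := fun j => h ((w j).1, (w i).2)) (a := a) (fun l hl => ?_) (fun l hl => ?_)
      (fun _ => hh _) (fun _ => hh _)
    · simp only [hne l hl]
    · simp only [hne l hl]

variable {p : Triple d → ℝ≥0∞}

/-- Concentration of the average over the product batch around its mean. -/
theorem measureReal_prodBatch_le (hp : IsDensity p) {k m : ℕ} {I : Finset (Fin n)}
    (hI : I.card = m) (hk0 : 0 < k) (hkm : k ≤ m) (hk : k ≤ Iᶜ.card) {h : Triple d → ℝ}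
    (hhm : Measurable h) {a C : ℝ} (hC : 0 ≤ C) (hh : ∀ v, h v ∈ Set.Icc a (a + C)) {ε : ℝ}
    (hε : 0 ≤ ε) :
    (Measure.pi fun _ : Fin n => jointLaw p).real {w | ε ≤
      |(1 / ((m * k : ℕ) : ℝ)) * prodBatchSum k I h w -
        ∫ w', (1 / ((m * k : ℕ) : ℝ)) * prodBatchSum k I h w'
          ∂(Measure.pi fun _ : Fin n => jointLaw p)|}
      ≤ 2 * Real.exp (-2 * ε ^ 2 * (k : ℝ) ^ 2 / ((n : ℝ) * C ^ 2)) := by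
  have := hp.isProbabilityMeasure
  have hk' : (0 : ℝ) < k := by exact_mod_cast hk0
  have hm' : (0 : ℝ) < m := by exact_mod_cast hk0.trans_le hkm
  refine (measureReal_abs_sub_integral_ge_le_of_bounded_differences (jointLaw p) _
    ((measurable_prodBatchSum k I hhm).const_mul _) (fun _ => C / k)
    (fun _ => by positivity) (fun w i v => ?_) hε).trans (le_of_eq ?_)
  · have h1 := abs_prodBatchSum_update_sub_le hI hk0 hkm hk hh w i v
    rw [← mul_sub, abs_mul, abs_of_nonneg (by positivity)]
    calc _ ≤ 1 / ((m * k : ℕ) : ℝ) * (m * C) := by gcongr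
      _ = C / k := by push_cast; field_simp
  · congr 2
    simp only [Finset.sum_const, Finset.card_univ, Fintype.card_fin, nsmul_eq_mul]
    rw [div_pow, mul_div_assoc', div_div_eq_mul_div]

theorem integrable_of_mem_Icc {α : Type*} [MeasurableSpace α] {μ : Measure α} [IsFiniteMeasure μ]
    {h : α → ℝ} (hhm : Measurable h) {a b : ℝ} (hh : ∀ v, h v ∈ Set.Icc a b) : Integrable h μ :=
  Integrable.of_mem_Icc a b hhm.aemeasurable (ae_of_all _ hh)

/-- The mean of the average over the product batch tends to the mean under the product law. -/
theorem exists_abs_integral_prodBatch_sub_le (hd : 0 < d) (hp : IsDensity p) {h : Triple d → ℝ}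
    (hhm : Measurable h) {M : ℝ} (hh : ∀ v, h v ∈ Set.Icc 0 M) {η : ℝ} (hη : 0 < η) :
    ∃ ρ : ℝ, 0 < ρ ∧ ∀ (n : ℕ) (I : Finset (Fin n)) (k m : ℕ), I.card = m → 0 < m → 0 < k →
      k ≤ Iᶜ.card → (k : ℝ) ≤ ρ * Iᶜ.card →
      |∫ w, (1 / ((m * k : ℕ) : ℝ)) * prodBatchSum k I h w
        ∂(Measure.pi fun _ : Fin n => jointLaw p) - ∫ v, h v ∂(prodLaw p)| ≤ η := by
  have hP := hp.isProbabilityMeasure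
  have hQ := isProbabilityMeasure_prodLaw hp
  obtain ⟨ρ, hρ0, hρt, hρ⟩ := exists_lintegral_sum_isolatedNeighbors_close hd hp
    (f := fun v => ENNReal.ofReal (h v)) hhm.ennreal_ofReal (M := ENNReal.ofReal M)
    (fun w => ENNReal.ofReal_le_ofReal (hh w).2) ENNReal.ofReal_ne_top
    (η := ENNReal.ofReal η) (by simpa using hη)
  refine ⟨ρ.toReal, ENNReal.toReal_pos hρ0 hρt, fun n I k m hI hm0 hk0 hk hkρ => ?_⟩
  set π : Measure (Fin n → Triple d) := Measure.pi fun _ : Fin n => jointLaw p with hπ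
  set ℓ := ∫ v, h v ∂(prodLaw p) with hℓ
  have hℓ0 : 0 ≤ ℓ := integral_nonneg fun v => (hh v).1
  set T : Fin n → (Fin n → Triple d) → ℝ := fun i w =>
    ∑ j ∈ isolatedNeighbors I k (fun l => (w l).2.2) (w i).2.2, h ((w j).1, (w i).2) with hT
  have hTm : ∀ i, Measurable (T i) := fun i => measurable_sum_isolatedNeighbors I k i
    (F := fun j w => h ((w j).1, (w i).2)) fun j => by fun_prop
  have hT0 : ∀ i w, 0 ≤ T i w := fun i w => Finset.sum_nonneg fun j _ => (hh _).1
  have hTi : ∀ i, Integrable (T i) π := by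
    intro i
    refine integrable_of_mem_Icc (a := 0) (b := k * M) (hTm i) fun w => ⟨hT0 i w, ?_⟩
    have := Finset.sum_le_card_nsmul (isolatedNeighbors I k (fun l => (w l).2.2) (w i).2.2)
      (fun j => h ((w j).1, (w i).2)) M fun j _ => (hh _).2
    rwa [card_isolatedNeighbors I _ _ hk, nsmul_eq_mul] at this
  have hkρ' : (k : ℝ≥0∞) ≤ ρ * (Iᶜ.card : ℝ≥0∞) := by
    rw [← ENNReal.ofReal_toReal hρt, ← ENNReal.ofReal_natCast, ← ENNReal.ofReal_natCast,
      ← ENNReal.ofReal_mul ENNReal.toReal_nonneg]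
    exact ENNReal.ofReal_le_ofReal hkρ
  have hu : ∀ i ∈ I, |∫ w, T i w ∂π - k * ℓ| ≤ k * η := by
    intro i hi
    have hu0 : 0 ≤ ∫ w, T i w ∂π := integral_nonneg fun w => hT0 i w
    have h1 := hρ n I k i hi hk hkρ'
    have e1 : ∫⁻ w, (∑ j ∈ isolatedNeighbors I k (fun l => (w l).2.2) (w i).2.2,
        ENNReal.ofReal (h ((w j).1, (w i).2))) ∂π = ENNReal.ofReal (∫ w, T i w ∂π) := by
      rw [ofReal_integral_eq_lintegral_ofReal (hTi i) (ae_of_all _ fun w => hT0 i w)]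
      refine lintegral_congr fun w => ?_
      rw [hT, ENNReal.ofReal_sum_of_nonneg fun j _ => (hh _).1]
    have e2 : ∫⁻ v, ENNReal.ofReal (h v) ∂(prodLaw p) = ENNReal.ofReal ℓ := by
      rw [hℓ, ofReal_integral_eq_lintegral_ofReal (integrable_of_mem_Icc hhm hh)
        (ae_of_all _ fun v => (hh v).1)]
    rw [e1, e2, ← ENNReal.ofReal_natCast, ← ENNReal.ofReal_mul (by positivity),
      ← ENNReal.ofReal_mul (by positivity), ← ENNReal.ofReal_add (by positivity) (by positivity),
      ← ENNReal.ofReal_add (by positivity) (by positivity),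
      ENNReal.ofReal_le_ofReal_iff (by positivity),
      ENNReal.ofReal_le_ofReal_iff (by positivity)] at h1
    rw [abs_le]
    constructor <;> linarith [h1.1, h1.2]
  have hk' : (0 : ℝ) < k := by exact_mod_cast hk0
  have hm' : (0 : ℝ) < m := by exact_mod_cast hm0
  have e3 : ∫ w, (1 / ((m * k : ℕ) : ℝ)) * prodBatchSum k I h w ∂π - ℓ =
      (1 / ((m * k : ℕ) : ℝ)) * ∑ i ∈ I, (∫ w, T i w ∂π - k * ℓ) := by
    rw [integral_const_mul]
    have : ∫ w, prodBatchSum k I h w ∂π = ∑ i ∈ I, ∫ w, T i w ∂π :=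
      integral_finsetSum _ fun i _ => hTi i
    rw [this, Finset.sum_sub_distrib, Finset.sum_const, hI, nsmul_eq_mul]
    push_cast
    field_simp
  rw [e3, abs_mul, abs_of_nonneg (by positivity)]
  calc _ ≤ 1 / ((m * k : ℕ) : ℝ) * (m * (k * η)) := by
        gcongr
        refine (Finset.abs_sum_le_sum_abs _ _).trans ?_
        rw [← hI, ← nsmul_eq_mul I.card]
        exact Finset.sum_le_card_nsmul _ _ _ hu
    _ = η := by push_cast; field_simp

/-- Concentration of the average over the joint batch. -/
theorem measureReal_jointBatch_le (hp : IsDensity p) {b : ℕ} {J : Finset (Fin n)}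
    (hJ : J.card = b) (hb : 0 < b) {h : Triple d → ℝ} (hhm : Measurable h) {a C : ℝ}
    (hC : 0 ≤ C) (hh : ∀ v, h v ∈ Set.Icc a (a + C)) {ε : ℝ} (hε : 0 ≤ ε) :
    (Measure.pi fun _ : Fin n => jointLaw p).real {w | ε ≤
      |(1 / (b : ℝ)) * ∑ i ∈ J, h (w i) - ∫ v, h v ∂(jointLaw p)|}
      ≤ 2 * Real.exp (-2 * (b : ℝ) * ε ^ 2 / C ^ 2) := by
  classical
  have := hp.isProbabilityMeasure
  have hb' : (0 : ℝ) < b := by exact_mod_cast hb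
  have hint : ∫ w, (1 / (b : ℝ)) * ∑ i ∈ J, h (w i) ∂(Measure.pi fun _ : Fin n => jointLaw p) =
      ∫ v, h v ∂(jointLaw p) := by
    rw [integral_const_mul, integral_finsetSum]
    · have : ∀ i ∈ J, ∫ w, h (w i) ∂(Measure.pi fun _ : Fin n => jointLaw p) =
          ∫ v, h v ∂(jointLaw p) := fun i _ => by
        have hmp := measurePreserving_eval (fun _ : Fin n => jointLaw p) i
        rw [← integral_map hmp.measurable.aemeasurable hhm.aestronglyMeasurable (f := h),
          hmp.map_eq]
      rw [Finset.sum_congr rfl this, Finset.sum_const, hJ, nsmul_eq_mul]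
      field_simp
    · exact fun i _ => integrable_of_mem_Icc (hhm.comp (measurable_pi_apply i)) fun _ => hh _
  rw [← hint]
  refine (measureReal_abs_sub_integral_ge_le_of_bounded_differences (jointLaw p)
    (fun w : Fin n → Triple d => (1 / (b : ℝ)) * ∑ i ∈ J, h (w i))
    ((Finset.measurable_sum _ fun i _ => hhm.comp (measurable_pi_apply i)).const_mul _)
    (fun i => if i ∈ J then C / b else 0) (fun i => by positivity) (fun w i v => ?_) hε).trans
    (le_of_eq ?_)
  · rw [← mul_sub, ← Finset.sum_sub_distrib, abs_mul, abs_of_nonneg (by positivity)]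
    by_cases hi : i ∈ J
    · rw [if_pos hi, Finset.sum_eq_single_of_mem i hi fun l _ hl => by
        rw [Function.update_of_ne hl, sub_self]]
      have h1 := hh (Function.update w i v i)
      have h2 := hh (w i)
      have h3 : |h (Function.update w i v i) - h (w i)| ≤ C := by
        rw [abs_le]
        constructor <;> linarith [h1.1, h1.2, h2.1, h2.2]
      calc _ ≤ 1 / (b : ℝ) * C := by gcongr
        _ = C / b := by ring
    · rw [if_neg hi, Finset.sum_eq_zero fun l hl => by
        rw [Function.update_of_ne (by rintro rfl; exact hi hl), sub_self]]
      simp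
  · have hs : ∑ i : Fin n, (if i ∈ J then C / b else 0) ^ 2 = b * (C / b) ^ 2 := by
      simp_rw [ite_pow, zero_pow two_ne_zero]
      rw [Finset.sum_ite_mem, Finset.univ_inter, Finset.sum_const, hJ, nsmul_eq_mul]
    rw [hs]
    congr 2
    rcases eq_or_ne C 0 with h0 | h0
    · simp [h0]
    · field_simp

end Concentration

/-! ### Conditioning on the batches, and the proof of the proposition -/

section Assembly

/-- By independence, conditioning on `S = T` leaves the law of the data unchanged. A bound uniform
over subsets of size `s` then survives averaging; subsets of any other size have probability zero.
-/
theorem measureReal_randomSubset_le {Ω : Type*} [MeasurableSpace Ω] {P : Measure Ω}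
    [IsProbabilityMeasure P] {d n s : ℕ} {W : Fin n → Ω → Triple d} {S : Ω → Finset (Fin n)}
    {π : Measure (Fin n → Triple d)} (hW : HasLaw (fun ω i => W i ω) π P)
    (hS : IsRandomSubset P s W S) {A : Finset (Fin n) → Set (Fin n → Triple d)}
    (hA : ∀ T, MeasurableSet (A T)) {B : ℝ}
    (hB : ∀ T : Finset (Fin n), T.card = s → π.real (A T) ≤ B) :
    P.real {ω | (fun i => W i ω) ∈ A (S ω)} ≤ B := by
  classical
  have hSm := hS.uniform.aemeasurable
  set ν := P.map S with hν
  have hνp : IsProbabilityMeasure ν := Measure.isProbabilityMeasure_map hSm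
  have hsub : {ω | (fun i => W i ω) ∈ A (S ω)} ⊆
      ⋃ T ∈ (Finset.univ : Finset (Finset (Fin n))),
        (fun ω i => W i ω) ⁻¹' A T ∩ S ⁻¹' {T} := by
    intro ω hω
    simp only [Finset.mem_univ, Set.iUnion_true, Set.mem_iUnion]
    exact ⟨S ω, hω, rfl⟩
  have hterm : ∀ T : Finset (Fin n),
      P.real ((fun ω i => W i ω) ⁻¹' A T ∩ S ⁻¹' {T}) ≤ B * ν.real {T} := by
    intro T
    have h1 : P.real ((fun ω i => W i ω) ⁻¹' A T ∩ S ⁻¹' {T}) = π.real (A T) * ν.real {T} := by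
      rw [measureReal_def, hS.indep.measure_inter_preimage_eq_mul _ _ (hA T)
        (measurableSet_singleton T), ENNReal.toReal_mul, ← hW.map_eq, measureReal_def,
        measureReal_def, Measure.map_apply_of_aemeasurable hW.aemeasurable (hA T), hν,
        Measure.map_apply_of_aemeasurable hSm (measurableSet_singleton T)]
    rw [h1]
    by_cases hT : T.card = s
    · exact mul_le_mul_of_nonneg_right (hB T hT) measureReal_nonneg
    · have h0 : ν {T} = 0 := by
        rw [hν, hS.uniform.map_eq, uniformOn_eq_zero_iff (Finset.finite_toSet _)]
        ext U
        simp only [Set.mem_inter_iff, Finset.mem_coe, Finset.mem_powersetCard,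
          Set.mem_singleton_iff, Set.mem_empty_iff_false, iff_false, not_and]
        rintro ⟨-, hU⟩ rfl
        exact hT hU
      simp [measureReal_def, h0]
  have hsum : ∑ T : Finset (Fin n), ν.real {T} = 1 := by
    rw [sum_measureReal_singleton]
    simp
  calc _ ≤ _ := measureReal_mono hsub (measure_ne_top _ _)
    _ ≤ _ := measureReal_biUnion_finset_le _ _
    _ ≤ ∑ T : Finset (Fin n), B * ν.real {T} := Finset.sum_le_sum fun T _ => hterm T
    _ = B := by rw [← Finset.mul_sum, hsum, mul_one]

/-! ### Range of the losses and form of the expected loss -/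

theorem classifier_mem_Icc {d : ℕ} {τ : ℝ} (hτ : τ < 1 / 2) (f : Triple d → ℝ) (w : Triple d) :
    classifier τ f w ∈ Set.Icc τ (1 - τ) :=
  ⟨le_max_left _ _, max_le (by linarith) (min_le_left _ _)⟩

theorem measurable_classifier {d : ℕ} (τ : ℝ) {f : Triple d → ℝ} (hf : Measurable f) :
    Measurable (classifier τ f) :=
  measurable_const.max (measurable_const.min (continuous_sigmoid.measurable.comp hf))

theorem neg_log_mem_Icc {τ : ℝ} (hτ₀ : 0 < τ) {t : ℝ} (ht : t ∈ Set.Icc τ (1 - τ)) :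
    -Real.log t ∈ Set.Icc (-Real.log (1 - τ)) (-Real.log (1 - τ) + Real.log ((1 - τ) / τ)) := by
  have h1 := Real.log_le_log hτ₀ ht.1
  have h2 := Real.log_le_log (hτ₀.trans_le ht.1) ht.2
  have h3 : 0 < 1 - τ := by linarith [ht.1.trans ht.2]
  rw [Real.log_div h3.ne' hτ₀.ne']
  exact ⟨by linarith, by linarith⟩

theorem expectedLoss_eq {d : ℕ} {p : Triple d → ℝ≥0∞} (hp : IsDensity p) {q : ℝ} (hq0 : 0 ≤ q)
    (hq1 : q ≤ 1) {ω : Triple d → ℝ} {a b : ℝ} (hm1 : Measurable fun v => -Real.log (ω v))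
    (hm2 : Measurable fun v => -Real.log (1 - ω v))
    (h1 : ∀ v, -Real.log (ω v) ∈ Set.Icc a b) (h2 : ∀ v, -Real.log (1 - ω v) ∈ Set.Icc a b) :
    expectedLoss q p ω = q * ∫ v, -Real.log (ω v) ∂(jointLaw p) +
      (1 - q) * ∫ v, -Real.log (1 - ω v) ∂(prodLaw p) := by
  have hP := hp.isProbabilityMeasure
  have hQ := isProbabilityMeasure_prodLaw hp
  set F : ℝ × Triple d → ℝ := fun v =>
    v.1 * Real.log (ω v.2) + (1 - v.1) * Real.log (1 - ω v.2) with hF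
  have hl1 : Measurable fun v => Real.log (ω v) := by simpa [Function.comp_def] using measurable_neg.comp hm1
  have hl2 : Measurable fun v => Real.log (1 - ω v) := by simpa [Function.comp_def] using measurable_neg.comp hm2
  have hFm : Measurable F :=
    (measurable_fst.mul (hl1.comp measurable_snd)).add
      ((measurable_const.sub measurable_fst).mul (hl2.comp measurable_snd))
  have hdirac : ∀ (c : ℝ) (ρ : Measure (Triple d)) [IsProbabilityMeasure ρ],
      Integrable (fun v => F (c, v)) ρ →
      Integrable F ((Measure.dirac c).prod ρ) ∧
        ∫ v, F v ∂((Measure.dirac c).prod ρ) = ∫ v, F (c, v) ∂ρ := by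
    intro c ρ _ hint
    rw [Measure.dirac_prod]
    have hmk : Measurable (Prod.mk c : Triple d → ℝ × Triple d) := measurable_prodMk_left
    exact ⟨(integrable_map_measure hFm.aestronglyMeasurable hmk.aemeasurable).2 hint,
      integral_map hmk.aemeasurable hFm.aestronglyMeasurable⟩
  have e1 : (fun v => F (1, v)) = fun v => -(-Real.log (ω v)) := by funext v; simp [hF]
  have e0 : (fun v => F (0, v)) = fun v => -(-Real.log (1 - ω v)) := by funext v; simp [hF]
  obtain ⟨i1, j1⟩ := hdirac 1 (jointLaw p) (by
    rw [e1]; exact (integrable_of_mem_Icc hm1 h1).neg)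
  obtain ⟨i0, j0⟩ := hdirac 0 (prodLaw p) (by
    rw [e0]; exact (integrable_of_mem_Icc hm2 h2).neg)
  unfold expectedLoss labelledLaw
  rw [integral_add_measure (i1.smul_measure ENNReal.ofReal_ne_top)
    (i0.smul_measure ENNReal.ofReal_ne_top), integral_smul_measure, integral_smul_measure, j1, j0,
    e1, e0, integral_neg (fun v => -Real.log (ω v)), integral_neg (fun v => -Real.log (1 - ω v)),
    ENNReal.toReal_ofReal hq0,
    ENNReal.toReal_ofReal (by linarith)]
  simp only [smul_eq_mul]
  ring

/-- The lower bounds contained in the `Θ` conditions forbid a zero batch parameter, since the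
comparison functions are positive for `n > 0`. -/
theorem BatchSizes.eventually_pos {k m b : ℕ → ℕ} (h : BatchSizes k m b) :
    ∀ᶠ n in atTop, 0 < k n ∧ 0 < b n := by
  obtain ⟨ε₀, -, hk⟩ := h.k_growth
  filter_upwards [hk.2.eq_zero_imp, h.b_growth.2.eq_zero_imp, eventually_gt_atTop 0]
    with n h1 h2 hn
  have hn' : (0 : ℝ) < n := by exact_mod_cast hn
  constructor
  · rw [Nat.pos_iff_ne_zero]
    intro h0
    exact (Real.rpow_pos_of_pos hn' _).ne' (h1 (by simp [h0]))
  · rw [Nat.pos_iff_ne_zero]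
    intro h0
    exact hn'.ne' (h2 (by simp [h0]))

theorem first_term_le_delta2 (d n m k : ℕ) (τ ε : ℝ) :
    2 * Real.exp (-2 * ε ^ 2 * (k : ℝ) ^ 2 / ((n : ℝ) * Real.log ((1 - τ) / τ) ^ 2)) ≤
      delta2 d n m k τ ε := by
  unfold delta2 delta1
  rw [add_assoc]
  exact le_add_of_nonneg_right (by positivity)

end Assembly

end IsolatedKNN

theorem proposition1 {d : ℕ} (hd : 0 < d)
    (p : IsolatedKNN.Triple d → ENNReal) (hp : IsolatedKNN.IsDensity p)
    {Θ : Type*} (net : Θ → IsolatedKNN.Triple d → ℝ) (hnet : ∀ θ, Measurable (net θ))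
    (τ : ℝ) (hτ₀ : 0 < τ) (hτ : τ < 1 / 2)
    (k m b : ℕ → ℕ) (hsizes : IsolatedKNN.BatchSizes k m b)
    (μ : ℝ) (hμ : 0 < μ) (θ : Θ) :
    ∃ n₀ : ℕ, ∀ n : ℕ, n₀ < n →
      ∀ (Ω : Type*) [MeasurableSpace Ω] (P : MeasureTheory.Measure Ω)
        [MeasureTheory.IsProbabilityMeasure P]
        (W : Fin n → Ω → IsolatedKNN.Triple d) (J I : Ω → Finset (Fin n)),
        ProbabilityTheory.iIndepFun W P →
        (∀ i, ProbabilityTheory.HasLaw (W i) (IsolatedKNN.jointLaw p) P) →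
        IsolatedKNN.IsRandomSubset P (b n) W J →
        IsolatedKNN.IsRandomSubset P (m n) W I →
        P.real {ω | μ ≤ |IsolatedKNN.empiricalLoss (m n) (k n) (b n) (J ω) (I ω)
              (fun i => W i ω) (IsolatedKNN.classifier τ (net θ)) -
            IsolatedKNN.expectedLoss (IsolatedKNN.jointFraction (m n) (k n) (b n)) p
              (IsolatedKNN.classifier τ (net θ))|}
          ≤ IsolatedKNN.delta3 d n (m n) (k n) (b n) τ μ := by
  open IsolatedKNN in
  set ω := classifier τ (net θ) with hω
  set C := Real.log ((1 - τ) / τ) with hC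
  have hC0 : 0 ≤ C := Real.log_nonneg (by rw [le_div_iff₀ hτ₀]; linarith)
  have hωm : Measurable ω := measurable_classifier τ (hnet θ)
  have hm1 : Measurable fun v => -Real.log (ω v) := hωm.log.neg
  have hm2 : Measurable fun v => -Real.log (1 - ω v) := (measurable_const.sub hωm).log.neg
  have hr1 : ∀ v, -Real.log (ω v) ∈ Set.Icc (-Real.log (1 - τ)) (-Real.log (1 - τ) + C) :=
    fun v => neg_log_mem_Icc hτ₀ (classifier_mem_Icc hτ _ v)
  have hr2 : ∀ v, -Real.log (1 - ω v) ∈ Set.Icc (-Real.log (1 - τ)) (-Real.log (1 - τ) + C) :=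
    fun v => neg_log_mem_Icc hτ₀ (by
      have h : τ ≤ ω v ∧ ω v ≤ 1 - τ := classifier_mem_Icc hτ (net θ) v
      exact ⟨by linarith [h.2], by linarith [h.1]⟩)
  have hlog : 0 ≤ -Real.log (1 - τ) := by
    have := Real.log_nonpos (x := 1 - τ) (by linarith) (by linarith)
    linarith
  -- The tolerance must not depend on `n`, whereas `ε` does through `p₁`. Since `3 - 2 p₁ ≤ 3`,
  -- always `μ / 3 ≤ ε`, so `2 (μ / 3)` is at most the allowed bias `2ε`.
  obtain ⟨ρ, hρ, hbias⟩ := exists_abs_integral_prodBatch_sub_le hd hp hm2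
    (M := -Real.log (1 - τ) + C) (fun v => ⟨hlog.trans (hr2 v).1, (hr2 v).2⟩)
    (η := 2 * (μ / 3)) (by positivity)
  have hev : ∀ᶠ n in atTop, 0 < k n ∧ 0 < b n ∧ k n ≤ m n ∧ m n + k n ≤ n ∧
      (k n : ℝ) / ((n : ℝ) - (m n : ℝ)) ≤ ρ := by
    filter_upwards [hsizes.eventually_pos, hsizes.k_le_m, hsizes.m_add_k_le,
      hsizes.neighbors_sparse.eventually_le_const hρ] with n h1 h2 h3 h4
    exact ⟨h1.1, h1.2, h2, h3, h4⟩
  obtain ⟨n₀, hn₀⟩ := eventually_atTop.1 hev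
  refine ⟨n₀, fun n hn Ω _ P _ W J I hindep hlaw hJ hI => ?_⟩
  obtain ⟨hk0, hb0, hkm, hmk, hkρ⟩ := hn₀ n hn.le
  have hP := hp.isProbabilityMeasure
  set q := jointFraction (m n) (k n) (b n) with hq
  have hbR : (0 : ℝ) < b n := by exact_mod_cast hb0
  have hq0 : 0 ≤ q := by rw [hq, jointFraction]; positivity
  have hq1 : q ≤ 1 := by
    rw [hq, jointFraction]
    exact div_le_one_of_le₀ (le_add_of_nonneg_right (by positivity)) (by positivity)
  set ε := μ / (3 - 2 * q) with hε
  have h3q : 0 < 3 - 2 * q := by linarith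
  have hε0 : 0 < ε := by positivity
  have hε3 : μ / 3 ≤ ε := div_le_div_of_nonneg_left hμ.le h3q (by linarith)
  set π : Measure (Fin n → Triple d) := Measure.pi fun _ : Fin n => jointLaw p with hπ
  have hWπ : HasLaw (fun ω i => W i ω) π P := by
    refine ⟨aemeasurable_pi_lambda _ fun i => (hlaw i).aemeasurable, ?_⟩
    rw [(iIndepFun_iff_map_fun_eq_pi_map fun i => (hlaw i).aemeasurable).1 hindep, hπ]
    congr 1
    funext i
    exact (hlaw i).map_eq
  set ℓ₁ := ∫ v, -Real.log (ω v) ∂(jointLaw p) with hℓ₁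
  set ℓ₂ := ∫ v, -Real.log (1 - ω v) ∂(prodLaw p) with hℓ₂
  set F₁ : Finset (Fin n) → (Fin n → Triple d) → ℝ := fun S w =>
    (1 / (b n : ℝ)) * ∑ i ∈ S, -Real.log (ω (w i)) with hF₁
  set F₂ : Finset (Fin n) → (Fin n → Triple d) → ℝ := fun S w =>
    (1 / ((m n * k n : ℕ) : ℝ)) * prodBatchSum (k n) S (fun v => -Real.log (1 - ω v)) w with hF₂
  have hF₁m : ∀ S, Measurable (F₁ S) := fun S =>
    (Finset.measurable_sum _ fun i _ => hm1.comp (measurable_pi_apply i)).const_mul _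
  have hF₂m : ∀ S, Measurable (F₂ S) := fun S => (measurable_prodBatchSum _ S hm2).const_mul _
  have hset : ∀ {F : (Fin n → Triple d) → ℝ} (_ : Measurable F) (c t : ℝ),
      MeasurableSet {w | t ≤ |F w - c|} := fun hF c t =>
    measurableSet_le measurable_const (hF.sub_const c).abs
  have hjoint : P.real {o | (fun i => W i o) ∈ {w | ε ≤ |F₁ (J o) w - ℓ₁|}} ≤
      2 * Real.exp (-2 * (b n : ℝ) * ε ^ 2 / C ^ 2) :=
    measureReal_randomSubset_le hWπ hJ (A := fun S => {w | ε ≤ |F₁ S w - ℓ₁|})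
      (fun S => hset (hF₁m S) _ _) fun S hS =>
      measureReal_jointBatch_le hp hS hb0 hm1 hC0 hr1 hε0.le
  have hprod : P.real {o | (fun i => W i o) ∈ {w | 3 * ε ≤ |F₂ (I o) w - ℓ₂|}} ≤
      2 * Real.exp (-2 * ε ^ 2 * (k n : ℝ) ^ 2 / ((n : ℝ) * C ^ 2)) := by
    refine measureReal_randomSubset_le hWπ hI (A := fun S => {w | 3 * ε ≤ |F₂ S w - ℓ₂|})
      (fun S => hset (hF₂m S) _ _) fun S hS => ?_
    have hSc : Sᶜ.card = n - m n := by rw [Finset.card_compl, hS, Fintype.card_fin]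
    have hkS : k n ≤ Sᶜ.card := by omega
    have hScR : ((Sᶜ.card : ℕ) : ℝ) = (n : ℝ) - (m n : ℝ) := by
      rw [hSc, Nat.cast_sub (by omega)]
    have hpos : (0 : ℝ) < (n : ℝ) - (m n : ℝ) := by
      rw [← hScR]
      exact_mod_cast hk0.trans_le hkS
    have hb := hbias n S (k n) (m n) hS (hk0.trans_le hkm) hk0 hkS (by
      rw [hScR]; exact (div_le_iff₀ hpos).1 hkρ)
    -- A deviation of `3ε` from `ℓ₂`, less a bias of at most `2ε`, leaves a deviation of `ε` from
    -- the mean, to which McDiarmid's inequality applies.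
    refine (measureReal_mono fun w hw => ?_).trans
      (measureReal_prodBatch_le hp hS hk0 hkm hkS hm2 hC0 hr2 hε0.le)
    have h1 : 3 * ε ≤ |F₂ S w - ℓ₂| := hw
    have h2 := abs_sub_le (F₂ S w) (∫ w', F₂ S w' ∂π) ℓ₂
    change ε ≤ |F₂ S w - ∫ w', F₂ S w' ∂π|
    have h3 : |∫ w', F₂ S w' ∂π - ℓ₂| ≤ 2 * (μ / 3) := hb
    linarith
  have hsub : {o | μ ≤ |empiricalLoss (m n) (k n) (b n) (J o) (I o) (fun i => W i o) ω -
      expectedLoss q p ω|} ⊆ {o | (fun i => W i o) ∈ {w | 3 * ε ≤ |F₂ (I o) w - ℓ₂|}} ∪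
        {o | (fun i => W i o) ∈ {w | ε ≤ |F₁ (J o) w - ℓ₁|}} := by
    intro o ho
    have ho' : μ ≤ |empiricalLoss (m n) (k n) (b n) (J o) (I o) (fun i => W i o) ω -
      expectedLoss q p ω| := ho
    by_contra hno
    rw [Set.mem_union, not_or] at hno
    have h1 : |F₂ (I o) (fun i => W i o) - ℓ₂| < 3 * ε := not_le.1 hno.1
    have h2 : |F₁ (J o) (fun i => W i o) - ℓ₁| < ε := not_le.1 hno.2
    have e1 : jointBatchLoss (b n) (J o) (fun i => W i o) ω = F₁ (J o) (fun i => W i o) := by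
      simp only [jointBatchLoss, hF₁, Finset.sum_neg_distrib, mul_neg]
    rw [expectedLoss_eq hp hq0 hq1 hm1 hm2 hr1 hr2, empiricalLoss, ← hq, e1, prodBatchLoss_eq,
      ← hℓ₁, ← hℓ₂] at ho'
    have e2 : q * F₁ (J o) (fun i => W i o) + (1 - q) * F₂ (I o) (fun i => W i o) -
        (q * ℓ₁ + (1 - q) * ℓ₂) = q * (F₁ (J o) (fun i => W i o) - ℓ₁) +
          (1 - q) * (F₂ (I o) (fun i => W i o) - ℓ₂) := by ring
    have h3 : |q * (F₁ (J o) (fun i => W i o) - ℓ₁) +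
        (1 - q) * (F₂ (I o) (fun i => W i o) - ℓ₂)| < μ := by
      have h4 : ε * (3 - 2 * q) = μ := div_mul_cancel₀ _ h3q.ne'
      have h5 := abs_add_le (q * (F₁ (J o) (fun i => W i o) - ℓ₁))
        ((1 - q) * (F₂ (I o) (fun i => W i o) - ℓ₂))
      rw [abs_mul, abs_mul, abs_of_nonneg hq0, abs_of_nonneg (sub_nonneg.2 hq1)] at h5
      have h6 := mul_le_mul_of_nonneg_left h2.le hq0
      have h7 := mul_le_mul_of_nonneg_left h1.le (sub_nonneg.2 hq1)
      -- Strictness needs a positive weight on one of the strict bounds: the product term when `q =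
      -- 0`, the joint term otherwise.
      rcases hq0.eq_or_lt with h0 | h0
      · rw [← h0] at h5 h4 ⊢
        linarith
      · have h8 := mul_lt_mul_of_pos_left h2 h0
        linarith
    rw [← e2] at h3
    exact absurd ho' (not_le.2 h3)
  unfold delta3
  rw [← hq, ← hε, ← hC]
  refine (measureReal_mono hsub).trans ((measureReal_union_le _ _).trans
    (add_le_add (hprod.trans (first_term_le_delta2 d n (m n) (k n) τ ε)) (hjoint.trans_eq ?_)))
  congr 2
  rw [hε, div_pow, mul_pow]
  rw [mul_div_assoc', div_div]
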